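/- Throughout, point sets are finite subsets of the Euclidean plane. A point set is in \emph{general position} if no three of its points are collinear, and in \emph{general$^+$ position} if moreover no three lines through six distinct points of the set (each line through two of them) are concurrent. $\mathrm{CH}(P)$ denotes the set of vertices of the convex hull of $P$. A \emph{triangulation} of $P$ is a maximal set of segments with distinct endpoints in $P$, any two of which meet at most in a common endpoint. A bijection $f_0\colon \mathrm{CH}(P)\to\mathrm{CH}(Q)$ is \emph{cyclic} if $p_1p_2$ is an edge of the convex hull of $P$ if and only if $f_0(p_1)f_0(p_2)$ is an edge of the convex hull of $Q$. For positive integers $c_1,c_2,c_3$, a \emph{$(c_1,c_2,c_3)$-generalized double circle} is a point set $P$ in general position with exactly $3+c_1+c_2+c_3$ points, namely the three vertices $P_1,P_2,P_3$ of its convex hull and points $A_{i,j}$ ($1\le i\le 3$, $1\le j\le c_i$), such that for each $i$ (with $P_4=P_1$) the points $P_i,A_{i,1},\dots,A_{i,c_i},P_{i+1}$ are, in this order, the vertices of a convex polygon, and each of the segments $P_iA_{i,1}$, $A_{i,j}A_{i,j+1}$ ($1\le j<c_i$), $A_{i,c_i}P_{i+1}$ belongs to every triangulation of $P$. For a cyclic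 bijection $f_0\colon \mathrm{CH}(P)\to\mathrm{CH}(Q)$, let $\mathcal T(P,Q,f_0)$ be the minimum $k\ge 0$ for which there are point sets $S_P,S_Q$ of $k$ points each, with $P\cap S_P=Q\cap S_Q=\varnothing$, such that $P\cup S_P$ and $Q\cup S_Q$ are in general position, $\mathrm{CH}(P\cup S_P)=\mathrm{CH}(P)$, $\mathrm{CH}(Q\cup S_Q)=\mathrm{CH}(Q)$, and there are a bijection $f\colon P\cup S_P\to Q\cup S_Q$ extending $f_0$ and triangulations $T_P$ of $P\cup S_P$ and $T_Q$ of $Q\cup S_Q$ such that $pq\in T_P$ if and only if $f(p)f(q)\in T_Q$, for all $p,q$. (The map $f$ need not send Steiner points to Steiner points; the minimum is $\infty$ if no such $k$ exists.) \textbf{Theorem.} Let $c_1,c_2,c_3$ be positive integers and let $P$ be a $(c_1,c_2,c_3)$-generalized double circle. Then for every point set $Q$ in general$^+$ position with $|Q|=|P|$ and $|\mathrm{CH}(Q)|=|\mathrm{CH}(P)|$, and every cyclic bijection $f_0\colon\mathrm{CH}(P)\to\mathrm{CH}(Q)$, $$\mathcal T(P,Q,f_0)\le 1 .$$ That is, at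 most one Steiner point per set suffices, regardless of the number of interior points. -/

import Mathlib

namespace CompatTri

/-- The Euclidean plane. -/
abbrev Plane : Type := EuclideanSpace ℝ (Fin 2)

/-- Twice the signed area of the triangle `p q r`; it is positive exactly when `(p, q, r)` is
in counterclockwise order. -/
def orient (p q r : Plane) : ℝ :=
  (q 0 - p 0) * (r 1 - p 1) - (q 1 - p 1) * (r 0 - p 0)

/-- No three (distinct) points of `P` are collinear. -/
def GeneralPosition (P : Set Plane) : Prop :=
  ∀ p ∈ P, ∀ q ∈ P, ∀ r ∈ P, p ≠ q → p ≠ r → q ≠ r → ¬ Collinear ℝ {p, q, r}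

/-- General⁺ position: general position, and no three lines through six distinct points of `P`
are concurrent. -/
def GeneralPlusPosition (P : Set Plane) : Prop :=
  GeneralPosition P ∧
    ∀ p : Fin 6 → Plane, Function.Injective p → (∀ i, p i ∈ P) →
      ¬ ∃ x : Plane, x ∈ line[ℝ, p 0, p 1] ∧ x ∈ line[ℝ, p 2, p 3] ∧ x ∈ line[ℝ, p 4, p 5]

/-- `CH(P)`, as a set of points: the vertices of the convex hull of `P`. -/
def hull (P : Set Plane) : Set Plane := (convexHull ℝ P).extremePoints ℝ

/-- `p q` is an edge of the convex hull of `P`: all of `P` lies on one side of the line `p q`. -/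
def IsHullEdge (P : Set Plane) (p q : Plane) : Prop :=
  p ∈ hull P ∧ q ∈ hull P ∧ p ≠ q ∧
    ((∀ r ∈ P, 0 ≤ orient p q r) ∨ (∀ r ∈ P, orient p q r ≤ 0))

/-- A bijection `CH(P) → CH(Q)` is cyclic if it preserves and reflects hull edges. -/
def IsCyclicMap {P Q : Set Plane} (f₀ : hull P ≃ hull Q) : Prop :=
  ∀ p₁ p₂ : hull P, IsHullEdge P p₁ p₂ ↔ IsHullEdge Q (f₀ p₁) (f₀ p₂)

/-- A set of edges of `P` is a simple graph on `P`. It is non-intersecting if two different edges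
meet at most in a common endpoint. -/
def NonIntersecting {P : Set Plane} (T : SimpleGraph P) : Prop :=
  ∀ a b c d : P, T.Adj a b → T.Adj c d → s(a, b) ≠ s(c, d) →
    segment ℝ (a : Plane) b ∩ segment ℝ (c : Plane) d ⊆ {(a : Plane), (b : Plane)} ∩ {(c : Plane), (d : Plane)}

/-- A triangulation of `P` is a maximal set of non-intersecting edges of `P`. -/
def IsTriangulation {P : Set Plane} (T : SimpleGraph P) : Prop :=
  Maximal NonIntersecting T

/-- `(T, U)` is a compatible triangulation of `(P, Q)` with respect to the bijection `f`. -/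
def IsCompatibleTriangulation {P Q : Set Plane} (f : P ≃ Q)
    (T : SimpleGraph P) (U : SimpleGraph Q) : Prop :=
  IsTriangulation T ∧ IsTriangulation U ∧ ∀ a b : P, T.Adj a b ↔ U.Adj (f a) (f b)

/-- The edge `p q` of `P` belongs to every triangulation of `P`. -/
def IsUnavoidableEdge (P : Set Plane) (p q : Plane) : Prop :=
  ∃ (hp : p ∈ P) (hq : q ∈ P), ∀ T : SimpleGraph P, IsTriangulation T → T.Adj ⟨p, hp⟩ ⟨q, hq⟩

/-- `v 0, v 1, …, v m` are, in this order, the vertices of a (strictly) convex polygon. -/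
def IsConvexPolygon (m : ℕ) (v : ℕ → Plane) : Prop :=
  (∀ j k l : ℕ, j < k → k < l → l ≤ m → 0 < orient (v j) (v k) (v l)) ∨
    (∀ j k l : ℕ, j < k → k < l → l ≤ m → orient (v j) (v k) (v l) < 0)

/-- `P` is a `(c 0, c 1, c 2)`-generalized double circle (three hull vertices). The point `V i 0`
is the hull vertex `P_i`, the points `V i 1, …, V i (c i)` are the points `A_{i,1}, …, A_{i,c_i}`
along the hull edge `P_i P_{i+1}`, and `V i (c i + 1)` is again `P_{i+1}` (indices mod 3). -/
def IsGeneralizedDoubleCircle (c : Fin 3 → ℕ) (P : Set Plane) : Prop :=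
  GeneralPosition P ∧
  ∃ V : Fin 3 → ℕ → Plane,
    (∀ i, V i (c i + 1) = V (i + 1) 0) ∧
    P = {x | ∃ i, ∃ j ≤ c i, x = V i j} ∧
    P.encard = ((3 + ∑ i, c i : ℕ) : ℕ∞) ∧
    hull P = Set.range (fun i => V i 0) ∧
    (∀ i, IsHullEdge P (V i 0) (V (i + 1) 0)) ∧
    (∀ i, IsConvexPolygon (c i + 1) (V i)) ∧
    (∀ i, ∀ j ≤ c i, IsUnavoidableEdge P (V i j) (V i (j + 1)))

/-- `P` and `Q` have a compatible triangulation with `k` Steiner points per set, with respect to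
some bijection extending `f₀`. The bijection need not send Steiner points to Steiner points. -/
def HasCompatibleTriangulationWithSteiner (P Q : Set Plane) (f₀ : hull P ≃ hull Q) (k : ℕ) :
    Prop :=
  ∃ S R : Set Plane,
    S.encard = (k : ℕ∞) ∧ R.encard = (k : ℕ∞) ∧
    Disjoint P S ∧ Disjoint Q R ∧
    GeneralPosition (P ∪ S) ∧ GeneralPosition (Q ∪ R) ∧
    hull (P ∪ S) = hull P ∧ hull (Q ∪ R) = hull Q ∧
    ∃ f : ↥(P ∪ S) ≃ ↥(Q ∪ R),
      (∀ (x : ↥(P ∪ S)) (y : hull P), (x : Plane) = y → (f x : Plane) = f₀ y) ∧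
      ∃ (T : SimpleGraph ↥(P ∪ S)) (U : SimpleGraph ↥(Q ∪ R)), IsCompatibleTriangulation f T U

/-- `𝒯(P, Q, f₀)`: the minimum `k` such that `P` and `Q` have a compatible triangulation with `k`
Steiner points extending `f₀` (and `⊤` if there is no such `k`). -/
noncomputable def steinerNumber (P Q : Set Plane) (f₀ : hull P ≃ hull Q) : ℕ∞ :=
  sInf {n : ℕ∞ | ∃ k : ℕ, n = k ∧ HasCompatibleTriangulationWithSteiner P Q f₀ k}

end CompatTri

namespace CompatTri

/-! One Steiner point is placed in each set and joined to all other points. Seen from such a center,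
the other points form three chains in angular order, one for each pair of consecutive hull corners
(`IsFan`). What remains to be triangulated are the three pockets between a side of the hull and its
chain. A chord of a pocket can be drawn exactly when the intermediate chain points lie on the
center's side of it (`IsMountain`). If each hull side has this property for its whole chain, then
such chords suffice to triangulate the pockets (`IsMountain.exists_split`,
`exists_triangulatedPolygon`). In a double circle the pockets are convex, so every chord is allowed.
A triangulation found in the pockets of `Q` can therefore be copied to `P` index by index
(`IsFan.exists_compatible`). It remains to find centers that give chains of equal lengths.

For `P`, unavoidable edges are crossed by no segment, which forces all points off a chain to the
inner side of each of its edges (`IsPocket.above`). Hence any three of the inner half-planes have a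
common point, and Helly's theorem gives a point in all of them (`IsDoubleCircle.exists_above_all`).
That point sees every chain in order.

For `Q`, the inner points must be split into classes of sizes `c i` such that class `i` lies in the
triangle spanned by the `i`-th side and the center. Take an assignment of minimal total cost, where
putting `p` into class `i` costs the logarithm of the area spanned by `p` and side `i`. Optimality
excludes improving exchanges along cycles of two or three classes, and general⁺ position makes these
inequalities strict: a tie for two points means collinearity with a corner, and a tie for three
means concurrent lines, by Ceva. So dual potentials exist (`exists_assignment_potentials`), and
their exponentials are barycentric coordinates of the center (`IsFrame.exists_partition`). -/

/-! ### Signed areas -/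

/-- The signed area `orient`, multiplied by a sign `s`, so that both orientations of a hull can be
treated at once. -/
def so (s : ℝ) (p q r : Plane) : ℝ := s * orient p q r

section SignedArea

variable {s : ℝ}

lemma so_rot (s : ℝ) (p q r : Plane) : so s p q r = so s q r p := by
  simp only [so, orient]; ring

lemma so_swap (s : ℝ) (p q r : Plane) : so s p r q = -so s p q r := by
  simp only [so, orient]; ring

lemma so_swap_left (s : ℝ) (p q r : Plane) : so s q p r = -so s p q r := by
  simp only [so, orient]; ring

@[simp] lemma so_self_left (s : ℝ) (p q : Plane) : so s p p q = 0 := by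
  simp only [so, orient]; ring

@[simp] lemma so_self_right (s : ℝ) (p q : Plane) : so s p q q = 0 := by
  simp only [so, orient]; ring

@[simp] lemma so_self_outer (s : ℝ) (p q : Plane) : so s p q p = 0 := by
  simp only [so, orient]; ring

lemma so_neg (s : ℝ) (p q r : Plane) : so (-s) p q r = -so s p q r := by
  simp only [so]; ring

lemma so_sum (s : ℝ) (a b c p : Plane) :
    so s a b p + so s b c p + so s c a p = so s a b c := by
  simp only [so, orient]; ring

/-- The three-term Grassmann–Plücker relation. It serves throughout to deduce one orientation at `x`
from the other five. -/
lemma so_plucker (s : ℝ) (x a b c d : Plane) :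
    so s x a b * so s x c d - so s x a c * so s x b d + so s x a d * so s x b c = 0 := by
  simp only [so, orient]; ring

/-- The height over the line `u v` is affine, so it can be expanded in the barycentric coordinates
of `p` with respect to `a`, `b`, `c`; denominators are cleared. -/
lemma so_barycentric (s : ℝ) (a b c u v p : Plane) :
    so s a b c * so s u v p =
      so s p b c * so s u v a + so s a p c * so s u v b + so s a b p * so s u v c := by
  simp only [so, orient]; ring

lemma so_combination (s : ℝ) (u v a b : Plane) {α β : ℝ} (h : α + β = 1) :
    so s u v (α • a + β • b) = α * so s u v a + β * so s u v b := by
  obtain rfl : β = 1 - α := by linarith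
  simp only [so, orient, PiLp.add_apply, PiLp.smul_apply, smul_eq_mul]; ring

lemma continuous_so (s : ℝ) (u v : Plane) : Continuous fun x => so s u v x := by
  unfold so orient; fun_prop

lemma plane_ext {p q : Plane} (h0 : p 0 = q 0) (h1 : p 1 = q 1) : p = q := by
  ext i; fin_cases i <;> assumption

lemma convex_so_pos (s : ℝ) (u v : Plane) : Convex ℝ {x | 0 < so s u v x} := by
  intro a ha b hb α β hα hβ h
  simp only [Set.mem_ofPred_eq] at *
  rw [so_combination _ _ _ _ _ h]
  rcases hα.eq_or_lt with rfl | hα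
  · obtain rfl : β = 1 := by linarith
    linarith
  · have := mul_pos hα ha
    have := mul_nonneg hβ hb.le
    linarith

lemma convex_so_nonneg (s : ℝ) (u v : Plane) : Convex ℝ {x | 0 ≤ so s u v x} := by
  intro a ha b hb α β hα hβ h
  simp only [Set.mem_ofPred_eq] at *
  rw [so_combination _ _ _ _ _ h]
  have := mul_nonneg hα ha
  have := mul_nonneg hβ hb
  linarith

lemma mem_line_of_orient_eq_zero {p q x : Plane} (hpq : p ≠ q) (h : orient p q x = 0) :
    x ∈ line[ℝ, p, q] := by
  have key : ∃ t : ℝ, x = AffineMap.lineMap p q t := by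
    simp only [orient] at h
    by_cases h0 : q 0 = p 0
    · have h1 : q 1 - p 1 ≠ 0 := fun h1 => hpq (plane_ext h0.symm (by linarith))
      refine ⟨(x 1 - p 1) / (q 1 - p 1), plane_ext ?_ ?_⟩ <;>
        simp only [AffineMap.lineMap_apply, vsub_eq_sub, vadd_eq_add, PiLp.add_apply,
          PiLp.smul_apply, PiLp.sub_apply, smul_eq_mul]
      · have : (q 1 - p 1) * (x 0 - p 0) = 0 := by rw [h0] at h; linarith
        have := (mul_eq_zero.1 this).resolve_left h1
        rw [h0]; linarith
      · field_simp; ring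
    · have h1 : q 0 - p 0 ≠ 0 := sub_ne_zero.2 h0
      refine ⟨(x 0 - p 0) / (q 0 - p 0), plane_ext ?_ ?_⟩ <;>
        simp only [AffineMap.lineMap_apply, vsub_eq_sub, vadd_eq_add, PiLp.add_apply,
          PiLp.smul_apply, PiLp.sub_apply, smul_eq_mul]
      · field_simp; ring
      · field_simp; linarith
  obtain ⟨t, rfl⟩ := key
  exact AffineMap.lineMap_mem_affineSpan_pair t p q

lemma collinear_iff_orient {p q r : Plane} (hpq : p ≠ q) :
    Collinear ℝ {p, q, r} ↔ orient p q r = 0 := by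
  constructor
  · intro h
    obtain ⟨w, hw⟩ := (collinear_iff_of_mem (p₀ := p) (by simp)).1 h
    obtain ⟨a, ha⟩ := hw q (by simp)
    obtain ⟨b, hb⟩ := hw r (by simp)
    subst ha hb
    simp [orient]; ring
  · intro h
    have hm := mem_line_of_orient_eq_zero hpq h
    have := collinear_insert_of_mem_affineSpan_pair hm
    convert this using 1
    ext y; simp; tauto

lemma GeneralPosition.so_ne_zero {P : Set Plane} (hP : GeneralPosition P) (hs : s ≠ 0)
    {p q r : Plane} (hp : p ∈ P) (hq : q ∈ P) (hr : r ∈ P) (hpq : p ≠ q) (hpr : p ≠ r)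
    (hqr : q ≠ r) : so s p q r ≠ 0 := by
  have := hP p hp q hq r hr hpq hpr hqr
  rw [collinear_iff_orient hpq] at this
  exact mul_ne_zero hs this

/-! ### Crossing and separated segments -/

lemma exists_mem_segment_inter {a b c d : Plane} (h1 : 0 < so s a b c) (h2 : so s a b d ≤ 0)
    (h3 : so s c d a < 0) (h4 : 0 < so s c d b) :
    ∃ z, z ∈ segment ℝ a b ∧ z ∈ segment ℝ c d := by
  -- Both differences are the cross product of the two directions, so one denominator normalizes the
  -- weights on both segments.
  have hD : so s a b c - so s a b d = so s c d b - so s c d a := by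
    simp only [so, orient]; ring
  have hpos : 0 < so s c d b - so s c d a := by linarith
  refine ⟨(so s c d b / (so s c d b - so s c d a)) • a +
      (-so s c d a / (so s c d b - so s c d a)) • b,
    ⟨_, _, by positivity, div_nonneg (by linarith) hpos.le, by field_simp; ring, rfl⟩,
    -so s a b d / (so s c d b - so s c d a), so s a b c / (so s c d b - so s c d a),
    div_nonneg (by linarith) hpos.le, by positivity, by field_simp; linarith, ?_⟩
  apply plane_ext <;>
  · simp only [PiLp.add_apply, PiLp.smul_apply, smul_eq_mul]
    field_simp
    simp only [so, orient]; ring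

lemma disjoint_segment_of_lt {u w a b c d : Plane} (ha : so s u w a < 0) (hb : so s u w b < 0)
    (hc : 0 ≤ so s u w c) (hd : 0 ≤ so s u w d) : segment ℝ a b ∩ segment ℝ c d = ∅ := by
  ext z
  simp only [Set.mem_inter_iff, Set.mem_empty_iff_false, iff_false, not_and]
  rintro ⟨α, β, hα, hβ, h, rfl⟩ ⟨γ, δ, hγ, hδ, h', hz⟩
  have e := so_combination s u w a b h
  rw [← hz, so_combination s u w c d h'] at e
  have := mul_nonneg hγ hc
  have := mul_nonneg hδ hd
  rcases hα.eq_or_lt with rfl | hα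
  · obtain rfl : β = 1 := by linarith
    linarith
  · nlinarith [mul_nonneg hβ (neg_pos.2 hb).le, mul_pos hα (neg_pos.2 ha)]

lemma eq_left_of_so_eq_zero {u w a b z : Plane} (ha : so s u w a ≤ 0) (hb : so s u w b < 0)
    (hz : z ∈ segment ℝ a b) (h : 0 ≤ so s u w z) : z = a := by
  obtain ⟨α, β, hα, hβ, e, rfl⟩ := hz
  rw [so_combination s u w a b e] at h
  rcases hβ.eq_or_lt with rfl | hβ
  · obtain rfl : α = 1 := by linarith
    simp
  · nlinarith [mul_pos hβ (neg_pos.2 hb), mul_nonneg hα (neg_nonneg.2 ha)]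

lemma so_nonpos_of_mem_segment {u w a b z : Plane} (ha : so s u w a ≤ 0) (hb : so s u w b ≤ 0)
    (hz : z ∈ segment ℝ a b) : so s u w z ≤ 0 := by
  obtain ⟨α, β, hα, hβ, e, rfl⟩ := hz
  rw [so_combination s u w a b e]
  nlinarith [mul_nonneg hα (neg_nonneg.2 ha), mul_nonneg hβ (neg_nonneg.2 hb)]

/-- A common point would lie on the separating line, which meets the first segment at most in `a`
and the second at most in `c`. -/
lemma disjoint_segment_of_le {u w a b c d : Plane} (ha : so s u w a ≤ 0) (hb : so s u w b < 0)
    (hc : 0 ≤ so s u w c) (hd : 0 < so s u w d) (hac : a ≠ c) :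
    segment ℝ a b ∩ segment ℝ c d = ∅ := by
  ext z
  simp only [Set.mem_inter_iff, Set.mem_empty_iff_false, iff_false, not_and]
  intro hz hz'
  have h1 := so_nonpos_of_mem_segment ha hb.le hz
  have h2 : so (-s) u w z ≤ 0 :=
    so_nonpos_of_mem_segment (by rw [so_neg]; linarith) (by rw [so_neg]; linarith) hz'
  rw [so_neg] at h2
  have h3 := eq_left_of_so_eq_zero ha hb hz (by linarith)
  have h4 := eq_left_of_so_eq_zero (s := -s) (u := u) (w := w) (by rw [so_neg]; linarith)
    (by rw [so_neg]; linarith) hz' (by rw [so_neg]; linarith)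
  exact hac (h3.symm.trans h4)

lemma inter_segment_subset_of_common_endpoint {a b c : Plane} (h : so s a b c ≠ 0) :
    segment ℝ a b ∩ segment ℝ a c ⊆ {a} := by
  rintro z ⟨⟨α, β, hα, hβ, e, rfl⟩, ⟨γ, δ, hγ, hδ, e', hz⟩⟩
  have h1 := so_combination s a b a b e
  rw [← hz, so_combination s a b a c e'] at h1
  simp only [so_self_outer, so_self_right, mul_zero, zero_add, mul_eq_zero, h, or_false] at h1
  subst h1
  obtain rfl : γ = 1 := by linarith
  simp [← hz]

end SignedArea

/-! ### Fans of chains -/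

/-- Three chains of points `v i 0, …, v i (c i + 1)`, each joining two consecutive vertices of a
triangle, and each of them seen in angular order from the point `x`. -/
structure IsFan (s : ℝ) (c : Fin 3 → ℕ) (x : Plane) (v : Fin 3 → ℕ → Plane) : Prop where
  glue : ∀ i, v i (c i + 1) = v (i + 1) 0
  fan : ∀ i j k, j < k → k ≤ c i + 1 → 0 < so s x (v i j) (v i k)
  -- Each corner is strictly higher over the opposite side than the center and all other points, so
  -- it lies in no triangle formed by them.
  corner_center : ∀ i, so s (v (i + 1) 0) (v (i + 2) 0) x <
    so s (v (i + 1) 0) (v (i + 2) 0) (v i 0)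
  corner : ∀ i i' j, j ≤ c i' → v i' j ≠ v i 0 → so s (v (i + 1) 0) (v (i + 2) 0) (v i' j) <
    so s (v (i + 1) 0) (v (i + 2) 0) (v i 0)

/-- The points of a fan other than its center. -/
def chainPoints (c : Fin 3 → ℕ) (v : Fin 3 → ℕ → Plane) : Set Plane :=
  {p | ∃ i, ∃ j ≤ c i, p = v i j}

/-- The sets of diagonals and sides of a polygon with vertices `0, …, m` that form a
triangulation. -/
structure IsTriangulatedPolygon (m : ℕ) (E : ℕ → ℕ → Prop) : Prop where
  lt : ∀ j k, E j k → j < k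
  le : ∀ j k, E j k → k ≤ m
  laminar : ∀ j k l n, E j k → E l n → ¬(j < l ∧ l < k ∧ k < n)
  maximal : ∀ j k, j < k → k ≤ m → ¬E j k →
    ∃ l n, E l n ∧ ((j < l ∧ l < k ∧ k < n) ∨ (l < j ∧ j < n ∧ n < k))

/-- All the points of the chain `w` strictly between `j` and `k` are on the positive side of the
line through `w j` and `w k`. -/
def IsMountain (s : ℝ) (w : ℕ → Plane) (j k : ℕ) : Prop :=
  ∀ l, j < l → l < k → 0 < so s (w j) (w k) (w l)

/-- `p q` is an edge from the center of a fan. -/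
def IsSpoke (c : Fin 3 → ℕ) (x : Plane) (v : Fin 3 → ℕ → Plane) (p q : Plane) : Prop :=
  p = x ∧ q ∈ chainPoints c v

/-- `p q` is an edge between two points of the same chain, selected by `E`. -/
def IsChainEdge (v : Fin 3 → ℕ → Plane) (E : Fin 3 → ℕ → ℕ → Prop) (p q : Plane) : Prop :=
  ∃ i j k, E i j k ∧ p = v i j ∧ q = v i k

lemma fin3_cases (i j : Fin 3) : j = i ∨ j = i + 1 ∨ i = j + 1 := by
  revert i j; decide

lemma fin3_add_three (i : Fin 3) : i + 1 + 1 + 1 = i := by revert i; decide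

lemma fin3_add_two (i : Fin 3) : i + 2 = i + 1 + 1 := by revert i; decide

namespace IsFan

variable {s : ℝ} {c : Fin 3 → ℕ} {x : Plane} {v : Fin 3 → ℕ → Plane} {E : Fin 3 → ℕ → ℕ → Prop}

lemma mem_chainPoints (h : IsFan s c x v) {i : Fin 3} {j : ℕ} (hj : j ≤ c i + 1) :
    v i j ∈ chainPoints c v := by
  rcases hj.lt_or_eq with hj | rfl
  · exact ⟨i, j, by omega, rfl⟩
  · exact ⟨i + 1, 0, by omega, h.glue i⟩

lemma ne_center (h : IsFan s c x v) {i : Fin 3} {j : ℕ} (hj : j ≤ c i) : v i j ≠ x := by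
  intro e
  have := h.fan i j (c i + 1) (by omega) le_rfl
  simp [e] at this

lemma ne_center' (h : IsFan s c x v) {p : Plane} (hp : p ∈ chainPoints c v) : p ≠ x := by
  obtain ⟨i, j, hj, rfl⟩ := hp
  exact h.ne_center hj

lemma injOn_chain (h : IsFan s c x v) {i : Fin 3} {j k : ℕ} (hj : j ≤ c i + 1) (hk : k ≤ c i + 1)
    (e : v i j = v i k) : j = k := by
  by_contra hne
  rcases Nat.lt_or_gt_of_ne hne with hlt | hlt
  · have := h.fan i j k hlt hk
    simp [e] at this
  · have := h.fan i k j hlt hj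
    simp [e] at this

lemma next_chain_ne (h : IsFan s c x v) {i : Fin 3} {j k : ℕ} (hj : j ≤ c i)
    (hk : k ≤ c (i + 1)) : v i j ≠ v (i + 1) k := by
  intro e
  have h1 := h.fan i j (c i + 1) (by omega) le_rfl
  rcases Nat.eq_zero_or_pos k with rfl | hk0
  · rw [← h.glue] at e
    simp [e] at h1
  · have h2 := h.fan (i + 1) 0 k hk0 (by omega)
    rw [h.glue, e, so_swap] at h1
    linarith

lemma injective (h : IsFan s c x v) {i i' : Fin 3} {j j' : ℕ} (hj : j ≤ c i) (hj' : j' ≤ c i')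
    (e : v i j = v i' j') : i = i' ∧ j = j' := by
  rcases fin3_cases i i' with rfl | rfl | rfl
  · exact ⟨rfl, h.injOn_chain (by omega) (by omega) e⟩
  · exact absurd e (h.next_chain_ne hj hj')
  · exact absurd e.symm (h.next_chain_ne hj' hj)

/-! #### Disjointness of the edges -/

/-- A spoke outside the angular range of the chord is separated from it by the spoke's own line, a
spoke inside the range by the line of the chord. -/
lemma disjoint_spoke_same (h : IsFan s c x v) {i : Fin 3} {j k l : ℕ}
    (hjk : j < k) (hk : k ≤ c i + 1) (hl : l ≤ c i + 1) (hm : IsMountain s (v i) j k)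
    (hlj : l ≠ j) (hlk : l ≠ k) :
    segment ℝ x (v i l) ∩ segment ℝ (v i j) (v i k) = ∅ := by
  rcases Nat.lt_or_gt_of_ne hlj with h1 | h1
  · rw [Set.inter_comm]
    refine disjoint_segment_of_lt (s := -s) (u := x) (w := v i l) ?_ ?_ ?_ ?_
    · rw [so_neg]; linarith [h.fan i l j h1 (by omega)]
    · rw [so_neg]; linarith [h.fan i l k (by omega) (by omega)]
    · simp
    · simp
  rcases Nat.lt_or_gt_of_ne hlk with h2 | h2
  · refine disjoint_segment_of_lt (s := -s) (u := v i j) (w := v i k) ?_ ?_ ?_ ?_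
    · rw [so_neg, ← so_rot]; linarith [h.fan i j k hjk hk]
    · rw [so_neg]; linarith [hm l h1 h2]
    · simp
    · simp
  · rw [Set.inter_comm]
    refine disjoint_segment_of_lt (s := s) (u := x) (w := v i l) ?_ ?_ ?_ ?_
    · rw [so_swap]; linarith [h.fan i j l (by omega) (by omega)]
    · rw [so_swap]; linarith [h.fan i k l (by omega) (by omega)]
    · simp
    · simp

lemma disjoint_spoke (h : IsFan s c x v) {i : Fin 3} {j k : ℕ}
    (hjk : j < k) (hk : k ≤ c i + 1) (hm : IsMountain s (v i) j k) {p : Plane}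
    (hp : p ∈ chainPoints c v) (hpj : p ≠ v i j) (hpk : p ≠ v i k) :
    segment ℝ x p ∩ segment ℝ (v i j) (v i k) = ∅ := by
  obtain ⟨i', l, hl, rfl⟩ := hp
  rcases fin3_cases i i' with rfl | rfl | rfl
  · exact h.disjoint_spoke_same hjk hk (by omega) hm (fun e => hpj (by rw [e]))
      (fun e => hpk (by rw [e]))
  · rcases Nat.eq_zero_or_pos l with rfl | hl0
    · rw [← h.glue] at *
      exact h.disjoint_spoke_same hjk hk le_rfl hm (fun e => hpj (by rw [e]))
        (fun e => hpk (by rw [e]))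
    · rw [Set.inter_comm, segment_symm ℝ (v i j)]
      refine disjoint_segment_of_le (s := s) (u := x) (w := v (i + 1) 0) ?_ ?_ ?_ ?_ ?_
      · rw [← h.glue, so_swap]
        rcases hk.lt_or_eq with hk | rfl
        · linarith [h.fan i k (c i + 1) hk le_rfl]
        · simp
      · rw [← h.glue, so_swap]
        linarith [h.fan i j (c i + 1) (by omega) le_rfl]
      · simp
      · exact h.fan _ _ _ hl0 (by omega)
      · exact h.ne_center' (h.mem_chainPoints hk)
  · refine disjoint_segment_of_le (s := s) (u := x) (w := v (i' + 1) 0) ?_ ?_ ?_ ?_ ?_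
    · simp
    · rw [← h.glue, so_swap]
      linarith [h.fan i' l (c i' + 1) (by omega) le_rfl]
    · rcases Nat.eq_zero_or_pos j with rfl | hj0
      · simp
      · exact (h.fan _ 0 j hj0 (by omega)).le
    · exact h.fan _ 0 k (by omega) hk
    · exact (h.ne_center' (h.mem_chainPoints (by omega))).symm

/-- Chords over successive index ranges are separated by the line from the center through `v i k`;
of two nested chords, the longer one separates. -/
lemma disjoint_chain_same (h : IsFan s c x v) {i : Fin 3} {j k l n : ℕ}
    (hjk : j < k) (hk : k ≤ c i + 1) (hln : l < n) (hn : n ≤ c i + 1)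
    (hm : IsMountain s (v i) j k) (hkl : k ≠ l) (hkn : k ≠ n) (hjl : j < l)
    (hlam : ¬(j < l ∧ l < k ∧ k < n)) :
    segment ℝ (v i j) (v i k) ∩ segment ℝ (v i l) (v i n) = ∅ := by
  rcases Nat.lt_or_gt_of_ne hkl with h1 | h1
  · rw [segment_symm ℝ (v i j)]
    refine disjoint_segment_of_le (s := s) (u := x) (w := v i k) ?_ ?_ ?_ ?_ ?_
    · simp
    · rw [so_swap]; linarith [h.fan i j k hjk hk]
    · exact (h.fan i k l h1 (by omega)).le
    · exact h.fan i k n (by omega) hn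
    · exact fun e => hkl (h.injOn_chain hk (by omega) e)
  · have hnk : n < k := by
      by_contra hc
      exact hlam ⟨hjl, h1, by omega⟩
    rw [Set.inter_comm]
    refine disjoint_segment_of_lt (s := -s) (u := v i j) (w := v i k) ?_ ?_ ?_ ?_
    · rw [so_neg]; linarith [hm l hjl h1]
    · rw [so_neg]; linarith [hm n (by omega) hnk]
    · simp
    · simp

lemma disjoint_chain_next (h : IsFan s c x v) {i : Fin 3} {j k l n : ℕ}
    (hjk : j < k) (hk : k ≤ c i + 1) (hln : l < n) (hn : n ≤ c (i + 1) + 1)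
    (hkl : v i k ≠ v (i + 1) l) :
    segment ℝ (v i j) (v i k) ∩ segment ℝ (v (i + 1) l) (v (i + 1) n) = ∅ := by
  rw [segment_symm ℝ (v i j)]
  refine disjoint_segment_of_le (s := s) (u := x) (w := v (i + 1) 0) ?_ ?_ ?_ ?_ hkl
  · rw [← h.glue, so_swap]
    rcases hk.lt_or_eq with hk | rfl
    · linarith [h.fan i k (c i + 1) hk le_rfl]
    · simp
  · rw [← h.glue, so_swap]
    linarith [h.fan i j (c i + 1) (by omega) le_rfl]
  · rcases Nat.eq_zero_or_pos l with rfl | hl0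
    · simp
    · exact (h.fan _ 0 l hl0 (by omega)).le
  · exact h.fan _ 0 n (by omega) hn

lemma disjoint_chain (h : IsFan s c x v) (hE : ∀ i, IsTriangulatedPolygon (c i + 1) (E i))
    (hm : ∀ i j k, E i j k → IsMountain s (v i) j k) {p q r t : Plane}
    (hpq : IsChainEdge v E p q) (hrt : IsChainEdge v E r t)
    (hpr : p ≠ r) (hpt : p ≠ t) (hqr : q ≠ r) (hqt : q ≠ t) :
    segment ℝ p q ∩ segment ℝ r t = ∅ := by
  obtain ⟨i, j, k, e, rfl, rfl⟩ := hpq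
  obtain ⟨i', l, n, e', rfl, rfl⟩ := hrt
  have h1 := (hE i).lt _ _ e
  have h2 := (hE i).le _ _ e
  have h3 := (hE i').lt _ _ e'
  have h4 := (hE i').le _ _ e'
  rcases fin3_cases i i' with rfl | rfl | rfl
  · have hjl : j ≠ l := fun e => hpr (by rw [e])
    have hjn : j ≠ n := fun e => hpt (by rw [e])
    have hkl : k ≠ l := fun e => hqr (by rw [e])
    have hkn : k ≠ n := fun e => hqt (by rw [e])
    rcases Nat.lt_or_gt_of_ne hjl with hlt | hlt
    · exact h.disjoint_chain_same h1 h2 h3 h4 (hm _ _ _ e) hkl hkn hlt ((hE _).laminar _ _ _ _ e e')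
    · rw [Set.inter_comm]
      exact h.disjoint_chain_same h3 h4 h1 h2 (hm _ _ _ e') hjn.symm hkn.symm hlt
        ((hE _).laminar _ _ _ _ e' e)
  · exact h.disjoint_chain_next h1 h2 h3 h4 hqr
  · rw [Set.inter_comm]
    exact h.disjoint_chain_next h3 h4 h1 h2 hpt.symm

lemma disjoint_spoke_chainEdge (h : IsFan s c x v)
    (hE : ∀ i, IsTriangulatedPolygon (c i + 1) (E i))
    (hm : ∀ i j k, E i j k → IsMountain s (v i) j k) {p q r t : Plane}
    (hpq : IsSpoke c x v p q) (hrt : IsChainEdge v E r t) (hqr : q ≠ r) (hqt : q ≠ t) :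
    segment ℝ p q ∩ segment ℝ r t = ∅ := by
  obtain ⟨rfl, hq⟩ := hpq
  obtain ⟨i, j, k, e, rfl, rfl⟩ := hrt
  exact h.disjoint_spoke ((hE i).lt _ _ e) ((hE i).le _ _ e) (hm _ _ _ e) hq hqr hqt

/-! #### Crossings of the other pairs of points -/

/-- The corner is seen from `x` between `a` and `b`. If the spoke ended before reaching `a b`, the
corner would lie in the triangle `x a b`, although it is strictly higher over the opposite side than
all three vertices. -/
lemma exists_crossing_corner (h : IsFan s c x v) {a b : Plane} {i : Fin 3}
    (ha : a ∈ chainPoints c v) (hb : b ∈ chainPoints c v)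
    (hab : 0 < so s x a b) (haC : 0 < so s x a (v i 0)) (hCb : 0 < so s x (v i 0) b) :
    ∃ z, z ∈ segment ℝ a b ∧ z ∈ segment ℝ x (v i 0) := by
  have ha' : a ≠ v i 0 := by rintro rfl; simp at haC
  have hb' : b ≠ v i 0 := by rintro rfl; simp at hCb
  obtain ⟨i₁, j₁, hj₁, rfl⟩ := ha
  obtain ⟨i₂, j₂, hj₂, rfl⟩ := hb
  refine exists_mem_segment_inter (s := -s) (c := v i 0) (d := x) ?_ ?_ ?_ ?_ |>.imp
    fun z hz => ⟨hz.1, by rw [segment_symm]; exact hz.2⟩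
  · rw [so_neg]
    by_contra hcon
    have hbar := so_barycentric s x (v i₁ j₁) (v i₂ j₂) (v (i + 1) 0) (v (i + 2) 0) (v i 0)
    have hsum := so_sum s x (v i₁ j₁) (v i₂ j₂) (v i 0)
    have e1 : so s (v i 0) (v i₁ j₁) (v i₂ j₂) = so s (v i₁ j₁) (v i₂ j₂) (v i 0) := so_rot ..
    have e2 : so s x (v i 0) (v i₂ j₂) = so s (v i₂ j₂) x (v i 0) := (so_rot ..).symm
    have f0 := h.corner_center i
    have f1 := h.corner i i₁ j₁ hj₁ ha'
    have f2 := h.corner i i₂ j₂ hj₂ hb'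
    rw [e1] at hbar
    rw [← e2] at hsum
    have key : so s (v i₁ j₁) (v i₂ j₂) (v i 0) * (so s (v (i + 1) 0) (v (i + 2) 0) (v i 0) -
          so s (v (i + 1) 0) (v (i + 2) 0) x) +
        so s x (v i 0) (v i₂ j₂) * (so s (v (i + 1) 0) (v (i + 2) 0) (v i 0) -
          so s (v (i + 1) 0) (v (i + 2) 0) (v i₁ j₁)) +
        so s x (v i₁ j₁) (v i 0) * (so s (v (i + 1) 0) (v (i + 2) 0) (v i 0) -
          so s (v (i + 1) 0) (v (i + 2) 0) (v i₂ j₂)) = 0 := by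
      linear_combination hbar + so s (v (i + 1) 0) (v (i + 2) 0) (v i 0) * hsum
    linarith [mul_nonneg (show 0 ≤ so s (v i₁ j₁) (v i₂ j₂) (v i 0) by linarith)
      (sub_pos.2 f0).le, mul_pos hCb (sub_pos.2 f1), mul_pos haC (sub_pos.2 f2)]
  · rw [so_neg, ← so_rot]; linarith
  · rw [so_neg, so_rot]; linarith
  · rw [so_neg, so_rot, so_swap]; linarith

lemma exists_crossing_spoke_same (h : IsFan s c x v) {i : Fin 3} {j k : ℕ} (hk : k ≤ c i + 1)
    (hjk : j < k) (hm : ¬IsMountain s (v i) j k) :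
    ∃ l, j < l ∧ l < k ∧ ∃ z, z ∈ segment ℝ (v i j) (v i k) ∧ z ∈ segment ℝ x (v i l) := by
  simp only [IsMountain, not_forall, not_lt] at hm
  obtain ⟨l, hjl, hlk, hneg⟩ := hm
  refine ⟨l, hjl, hlk, exists_mem_segment_inter (s := s) ?_ hneg ?_ ?_⟩
  · rw [← so_rot]; exact h.fan i j k hjk hk
  · rw [so_swap]; linarith [h.fan i j l hjl (by omega)]
  · exact h.fan i l k hlk hk

/-- The mountain conditions put `v i l` and `v i k` on the center's side of the other chord. The
Plücker relations at these two points, together with the angular order around `x`, then force the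
outer endpoints to the far sides. -/
lemma exists_crossing_chain (h : IsFan s c x v) {i : Fin 3} {j l k n : ℕ} (hn : n ≤ c i + 1)
    (hjl : j < l) (hlk : l < k) (hkn : k < n) (hm : IsMountain s (v i) j k)
    (hm' : IsMountain s (v i) l n) :
    ∃ z, z ∈ segment ℝ (v i j) (v i k) ∧ z ∈ segment ℝ (v i l) (v i n) := by
  have a1 := hm l hjl hlk
  have a2 := hm' k hlk hkn
  have x1 := h.fan i j l hjl (by omega)
  have x2 := h.fan i j k (by omega) (by omega)
  have x3 := h.fan i j n (by omega) (by omega)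
  have x4 := h.fan i l k (by omega) (by omega)
  have x5 := h.fan i l n (by omega) (by omega)
  have x6 := h.fan i k n (by omega) (by omega)
  set J := v i j
  set K := v i k
  set L := v i l
  set N := v i n
  refine exists_mem_segment_inter (s := s) a1 ?_ ?_ a2
  · by_contra hc
    push Not at hc
    have := so_plucker s K J L N x
    have e1 : so s K J L = so s J L K := so_rot ..
    have e1' : so s J L K = - so s J K L := so_swap ..
    have e2 : so s K N x = so s x K N := (so_rot ..).symm
    have e3 : so s K J N = - so s J K N := so_swap_left ..
    have e4 : so s K L x = - so s x L K := by rw [← so_rot, so_swap]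
    have e5 : so s K J x = - so s x J K := by rw [← so_rot, so_swap]
    have e6 : so s K L N = so s L N K := so_rot ..
    rw [e1, e1', e2, e3, e4, e5, e6] at this
    nlinarith [mul_pos a1 x6, mul_nonneg hc.le x4.le, mul_pos x2 a2]
  · by_contra hc
    push Not at hc
    have := so_plucker s L J K N x
    have e1 : so s L J K = so s J K L := so_rot ..
    have e2 : so s L N x = so s x L N := (so_rot ..).symm
    have e3 : so s L J N = - so s L N J := so_swap ..
    have e4 : so s L K x = so s x L K := (so_rot ..).symm
    have e5 : so s L J x = - so s x J L := by rw [← so_rot, so_swap]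
    have e6 : so s L K N = - so s L N K := so_swap ..
    rw [e1, e2, e3, e4, e5, e6] at this
    nlinarith [mul_pos a1 x5, mul_nonneg hc x4.le, mul_pos x1 a2]

/-- A segment between two chains that have no common point with both of its endpoints crosses a
spoke to a corner. -/
lemma exists_crossing_corner_of_next (h : IsFan s c x v) {i : Fin 3} {j k : ℕ} (hj : j ≤ c i)
    (hk0 : 0 < k) (hk : k ≤ c (i + 1)) (hne : so s x (v i j) (v (i + 1) k) ≠ 0) :
    ∃ i', v i' 0 ≠ v i j ∧ v i' 0 ≠ v (i + 1) k ∧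
      ∃ z, z ∈ segment ℝ (v i j) (v (i + 1) k) ∧ z ∈ segment ℝ x (v i' 0) := by
  have ha : v i j ∈ chainPoints c v := ⟨_, _, hj, rfl⟩
  have hb : v (i + 1) k ∈ chainPoints c v := ⟨_, _, hk, rfl⟩
  have a1 : 0 < so s x (v i j) (v (i + 1) 0) := by
    rw [← h.glue]; exact h.fan i j _ (by omega) le_rfl
  have a2 := h.fan (i + 1) 0 k hk0 (by omega)
  rcases lt_or_gt_of_ne hne with hlt | hlt
  -- The turn over the shared corner exceeds a half-turn here, so the segment passes the center on
  -- the other side and meets the spoke to the third corner.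
  · have b1 := h.fan (i + 1) k _ (Nat.lt_succ_of_le hk) le_rfl
    have b2 := h.fan (i + 1) 0 _ (Nat.succ_pos _) le_rfl
    simp only [Nat.succ_eq_add_one, h.glue] at b1 b2
    have hba : 0 < so s x (v (i + 1) k) (v i j) := by rw [so_swap]; linarith
    have hp := so_plucker s x (v (i + 1) 0) (v (i + 1) k) (v (i + 1 + 1) 0) (v i j)
    have e : so s x (v (i + 1) 0) (v i j) = - so s x (v i j) (v (i + 1) 0) := so_swap ..
    have b3 : 0 < so s x (v (i + 1 + 1) 0) (v i j) := by
      rw [e] at hp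
      by_contra hc
      push Not at hc
      nlinarith [mul_pos b2 hba, mul_pos a1 b1, mul_nonneg a2.le (neg_nonneg.2 hc)]
    refine ⟨i + 1 + 1, ?_, ?_, ?_⟩
    · intro e; simp [e] at b3
    · intro e; simp [e] at b1
    · rw [segment_symm]
      exact h.exists_crossing_corner hb ha hba b1 b3
  · refine ⟨i + 1, ?_, ?_, h.exists_crossing_corner ha hb hlt a1 a2⟩
    · intro e; simp [e] at a1
    · intro e; simp [e] at a2

end IsFan

/-! ### The graph of a fan and its maximality -/

/-- The graph on `X` of the edges from `x` to all other points and the chain edges selected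
by `E`. -/
def fanGraph (X : Set Plane) (x : Plane) (v : Fin 3 → ℕ → Plane) (E : Fin 3 → ℕ → ℕ → Prop) :
    SimpleGraph X where
  Adj a b := a ≠ b ∧ ((a : Plane) = x ∨ (b : Plane) = x ∨ IsChainEdge v E a b ∨
    IsChainEdge v E b a)
  symm := ⟨fun a b h => ⟨h.1.symm, by tauto⟩⟩
  loopless := ⟨fun a h => h.1 rfl⟩

namespace IsFan

variable {s : ℝ} {c : Fin 3 → ℕ} {x : Plane} {v : Fin 3 → ℕ → Plane} {E : Fin 3 → ℕ → ℕ → Prop}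

lemma adj_cases {a b : ↥(chainPoints c v ∪ {x})}
    (hab : (fanGraph (chainPoints c v ∪ {x}) x v E).Adj a b) :
    (IsSpoke c x v a b ∨ IsSpoke c x v b a) ∨ (IsChainEdge v E a b ∨ IsChainEdge v E b a) := by
  obtain ⟨hne, h1 | h1 | h1⟩ := hab
  · refine Or.inl (Or.inl ⟨h1, b.2.resolve_right fun h2 => hne (Subtype.ext ?_)⟩)
    rw [h1, Set.mem_singleton_iff.1 h2]
  · refine Or.inl (Or.inr ⟨h1, a.2.resolve_right fun h2 => hne (Subtype.ext ?_)⟩)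
    rw [h1, Set.mem_singleton_iff.1 h2]
  · exact Or.inr h1

lemma disjoint_of_adj (h : IsFan s c x v) (hE : ∀ i, IsTriangulatedPolygon (c i + 1) (E i))
    (hm : ∀ i j k, E i j k → IsMountain s (v i) j k) {p q r t : ↥(chainPoints c v ∪ {x})}
    (hpq : (fanGraph (chainPoints c v ∪ {x}) x v E).Adj p q)
    (hrt : (fanGraph (chainPoints c v ∪ {x}) x v E).Adj r t)
    (hpr : p ≠ r) (hpt : p ≠ t) (hqr : q ≠ r) (hqt : q ≠ t) :
    segment ℝ (p : Plane) q ∩ segment ℝ (r : Plane) t = ∅ := by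
  have hpr' := Subtype.coe_injective.ne hpr
  have hpt' := Subtype.coe_injective.ne hpt
  have hqr' := Subtype.coe_injective.ne hqr
  have hqt' := Subtype.coe_injective.ne hqt
  rcases adj_cases hpq with h1 | h1 <;> rcases adj_cases hrt with h2 | h2
  · rcases h1 with h1 | h1 <;> rcases h2 with h2 | h2
    · exact absurd (h1.1.trans h2.1.symm) hpr'
    · exact absurd (h1.1.trans h2.1.symm) hpt'
    · exact absurd (h1.1.trans h2.1.symm) hqr'
    · exact absurd (h1.1.trans h2.1.symm) hqt'
  · rcases h1 with h1 | h1 <;> rcases h2 with h2 | h2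
    · exact h.disjoint_spoke_chainEdge hE hm h1 h2 hqr' hqt'
    · rw [segment_symm ℝ (r : Plane)]
      exact h.disjoint_spoke_chainEdge hE hm h1 h2 hqt' hqr'
    · rw [segment_symm ℝ (p : Plane)]
      exact h.disjoint_spoke_chainEdge hE hm h1 h2 hpr' hpt'
    · rw [segment_symm ℝ (p : Plane), segment_symm ℝ (r : Plane)]
      exact h.disjoint_spoke_chainEdge hE hm h1 h2 hpt' hpr'
  · rw [Set.inter_comm]
    rcases h1 with h1 | h1 <;> rcases h2 with h2 | h2
    · exact h.disjoint_spoke_chainEdge hE hm h2 h1 hpt'.symm hqt'.symm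
    · rw [segment_symm ℝ (r : Plane)]
      exact h.disjoint_spoke_chainEdge hE hm h2 h1 hpr'.symm hqr'.symm
    · rw [segment_symm ℝ (p : Plane)]
      exact h.disjoint_spoke_chainEdge hE hm h2 h1 hqt'.symm hpt'.symm
    · rw [segment_symm ℝ (p : Plane), segment_symm ℝ (r : Plane)]
      exact h.disjoint_spoke_chainEdge hE hm h2 h1 hqr'.symm hpr'.symm
  · rcases h1 with h1 | h1 <;> rcases h2 with h2 | h2
    · exact h.disjoint_chain hE hm h1 h2 hpr' hpt' hqr' hqt'
    · rw [segment_symm ℝ (r : Plane)]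
      exact h.disjoint_chain hE hm h1 h2 hpt' hpr' hqt' hqr'
    · rw [segment_symm ℝ (p : Plane)]
      exact h.disjoint_chain hE hm h1 h2 hqr' hqt' hpr' hpt'
    · rw [segment_symm ℝ (p : Plane), segment_symm ℝ (r : Plane)]
      exact h.disjoint_chain hE hm h1 h2 hqt' hqr' hpt' hpr'

end IsFan

lemma GeneralPosition.inter_segment_subset {X : Set Plane} (hX : GeneralPosition X) {p q r : X}
    (hpq : p ≠ q) (hpr : p ≠ r) (hqr : q ≠ r) :
    segment ℝ (p : Plane) q ∩ segment ℝ (p : Plane) r ⊆ {(p : Plane)} :=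
  inter_segment_subset_of_common_endpoint (hX.so_ne_zero one_ne_zero p.2 q.2 r.2
    (Subtype.coe_injective.ne hpq) (Subtype.coe_injective.ne hpr) (Subtype.coe_injective.ne hqr))

/-- Edges with a common endpoint meet only there by general position, so only pairs with four
distinct endpoints need to be checked. -/
lemma nonIntersecting_of_disjoint {X : Set Plane} (hX : GeneralPosition X) {T : SimpleGraph X}
    (hT : ∀ p q r t : X, T.Adj p q → T.Adj r t → p ≠ r → p ≠ t → q ≠ r → q ≠ t →
      segment ℝ (p : Plane) q ∩ segment ℝ (r : Plane) t = ∅) : NonIntersecting T := by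
  intro p q r t hpq hrt hne
  have hp := hpq.ne
  have hr := hrt.ne
  by_cases h1 : p = r
  · subst h1
    have : q ≠ t := by rintro rfl; exact hne rfl
    refine (hX.inter_segment_subset hp hr this).trans ?_
    simp
  by_cases h2 : p = t
  · subst h2
    have : q ≠ r := by rintro rfl; exact hne Sym2.eq_swap
    rw [segment_symm ℝ (r : Plane)]
    refine (hX.inter_segment_subset hp hr.symm this).trans ?_
    simp
  by_cases h3 : q = r
  · subst h3
    rw [segment_symm ℝ (p : Plane)]
    refine (hX.inter_segment_subset hp.symm hr h2).trans ?_
    simp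
  by_cases h4 : q = t
  · subst h4
    rw [segment_symm ℝ (p : Plane), segment_symm ℝ (r : Plane)]
    refine (hX.inter_segment_subset hp.symm hr.symm h1).trans ?_
    simp
  rw [hT p q r t hpq hrt h1 h2 h3 h4]
  exact Set.empty_subset _

/-- The segment `p q` is crossed by an edge of the graph `T` with other endpoints. -/
def IsCrossed {X : Set Plane} (T : SimpleGraph X) (p q : X) : Prop :=
  ∃ r t : X, T.Adj r t ∧ p ≠ r ∧ p ≠ t ∧ q ≠ r ∧ q ≠ t ∧
    ∃ z, z ∈ segment ℝ (p : Plane) q ∧ z ∈ segment ℝ (r : Plane) t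

lemma IsCrossed.symm {X : Set Plane} {T : SimpleGraph X} {p q : X}
    (h : IsCrossed T p q) : IsCrossed T q p := by
  obtain ⟨r, t, h, h1, h2, h3, h4, h5⟩ := h
  exact ⟨r, t, h, h3, h4, h1, h2, by rwa [segment_symm]⟩

namespace IsFan

variable {s : ℝ} {c : Fin 3 → ℕ} {x : Plane} {v : Fin 3 → ℕ → Plane} {E : Fin 3 → ℕ → ℕ → Prop}

lemma isCrossed_of_spoke (h : IsFan s c x v) {p q r : ↥(chainPoints c v ∪ {x})}
    (hp : (p : Plane) ∈ chainPoints c v) (hq : (q : Plane) ∈ chainPoints c v)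
    (hr : (r : Plane) ∈ chainPoints c v) (hpr : (p : Plane) ≠ r) (hqr : (q : Plane) ≠ r)
    (hz : ∃ z, z ∈ segment ℝ (p : Plane) q ∧ z ∈ segment ℝ x (r : Plane)) :
    IsCrossed (fanGraph (chainPoints c v ∪ {x}) x v E) p q := by
  refine ⟨⟨x, by simp⟩, r, ⟨?_, Or.inl rfl⟩, ?_, ?_, ?_, ?_, hz⟩
  · exact fun e => h.ne_center' hr (by rw [← e])
  · exact fun e => h.ne_center' hp (by rw [e])
  · exact fun e => hpr (by rw [e])
  · exact fun e => h.ne_center' hq (by rw [e])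
  · exact fun e => hqr (by rw [e])

/-- A chord with the mountain property is blocked by an interleaving chord from `E`; any other chord
cuts off a chain point and is blocked by the spoke to it. -/
lemma isCrossed_same (h : IsFan s c x v) (hE : ∀ i, IsTriangulatedPolygon (c i + 1) (E i))
    (hm : ∀ i j k, E i j k → IsMountain s (v i) j k) {p q : ↥(chainPoints c v ∪ {x})}
    {i : Fin 3} {j k : ℕ} (hjk : j < k) (hk : k ≤ c i + 1) (hp : (p : Plane) = v i j)
    (hq : (q : Plane) = v i k) (hpq : ¬E i j k) :
    IsCrossed (fanGraph (chainPoints c v ∪ {x}) x v E) p q := by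
  have hp' : (p : Plane) ∈ chainPoints c v := hp ▸ h.mem_chainPoints (by omega)
  have hq' : (q : Plane) ∈ chainPoints c v := hq ▸ h.mem_chainPoints (by omega)
  by_cases hM : IsMountain s (v i) j k
  · obtain ⟨l, n, hln, hcase⟩ := (hE i).maximal j k hjk hk hpq
    have hlt := (hE i).lt _ _ hln
    have hn := (hE i).le _ _ hln
    refine ⟨⟨v i l, Or.inl (h.mem_chainPoints (by omega))⟩,
      ⟨v i n, Or.inl (h.mem_chainPoints (by omega))⟩,
      ⟨fun e => hlt.ne (h.injOn_chain (by omega) hn (Subtype.ext_iff.1 e)),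
        Or.inr (Or.inr (Or.inl ⟨i, l, n, hln, rfl, rfl⟩))⟩, ?_, ?_, ?_, ?_, ?_⟩
    · intro e
      have := h.injOn_chain (by omega) (by omega) (hp.symm.trans (Subtype.ext_iff.1 e))
      omega
    · intro e
      have := h.injOn_chain (by omega) (by omega) (hp.symm.trans (Subtype.ext_iff.1 e))
      omega
    · intro e
      have := h.injOn_chain (by omega) (by omega) (hq.symm.trans (Subtype.ext_iff.1 e))
      omega
    · intro e
      have := h.injOn_chain (by omega) (by omega) (hq.symm.trans (Subtype.ext_iff.1 e))
      omega
    · rw [hp, hq]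
      rcases hcase with ⟨h1, h2, h3⟩ | ⟨h1, h2, h3⟩
      · exact h.exists_crossing_chain hn h1 h2 h3 hM (hm _ _ _ hln)
      · exact (h.exists_crossing_chain hk h1 h2 h3 (hm _ _ _ hln) hM).imp fun z hz => hz.symm
  · obtain ⟨l, h1, h2, hz⟩ := h.exists_crossing_spoke_same hk hjk hM
    refine h.isCrossed_of_spoke (r := ⟨v i l, Or.inl (h.mem_chainPoints (by omega))⟩) hp' hq'
      (h.mem_chainPoints (by omega)) ?_ ?_ (by rwa [hp, hq])
    · intro e
      have := h.injOn_chain (by omega) (by omega) (hp.symm.trans e)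
      omega
    · intro e
      have := h.injOn_chain (by omega) (by omega) (hq.symm.trans e)
      omega

lemma isCrossed_next (h : IsFan s c x v) (hs : s ≠ 0)
    (hX : GeneralPosition (chainPoints c v ∪ {x}))
    (hE : ∀ i, IsTriangulatedPolygon (c i + 1) (E i))
    (hm : ∀ i j k, E i j k → IsMountain s (v i) j k) {p q : ↥(chainPoints c v ∪ {x})}
    {i : Fin 3} {j k : ℕ} (hj : j ≤ c i) (hk : k ≤ c (i + 1)) (hp : (p : Plane) = v i j)
    (hq : (q : Plane) = v (i + 1) k)
    (hpq : ¬(fanGraph (chainPoints c v ∪ {x}) x v E).Adj p q) :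
    IsCrossed (fanGraph (chainPoints c v ∪ {x}) x v E) p q := by
  have hne : v i j ≠ v (i + 1) k := h.next_chain_ne hj hk
  have hne' : p ≠ q := fun e => hne (by rw [← hp, ← hq, e])
  rcases Nat.eq_zero_or_pos k with rfl | hk0
  · rw [← h.glue] at hq
    exact h.isCrossed_same hE hm (by omega) le_rfl hp hq fun he =>
      hpq ⟨hne', Or.inr (Or.inr (Or.inl ⟨i, _, _, he, hp, hq⟩))⟩
  · have hp' : (p : Plane) ∈ chainPoints c v := hp ▸ h.mem_chainPoints (by omega)
    have hq' : (q : Plane) ∈ chainPoints c v := hq ▸ h.mem_chainPoints (by omega)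
    have hso : so s x (v i j) (v (i + 1) k) ≠ 0 :=
      hX.so_ne_zero hs (by simp) (Or.inl (hp ▸ hp')) (Or.inl (hq ▸ hq'))
        (h.ne_center hj).symm (h.ne_center hk).symm hne
    obtain ⟨i', h1, h2, hz⟩ := h.exists_crossing_corner_of_next hj hk0 hk hso
    exact h.isCrossed_of_spoke (r := ⟨v i' 0, Or.inl (h.mem_chainPoints (by omega))⟩) hp' hq'
      (h.mem_chainPoints (by omega)) (by rw [hp]; exact h1.symm) (by rw [hq]; exact h2.symm)
      (by rwa [hp, hq])

lemma isCrossed_of_not_adj (h : IsFan s c x v) (hs : s ≠ 0)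
    (hX : GeneralPosition (chainPoints c v ∪ {x}))
    (hE : ∀ i, IsTriangulatedPolygon (c i + 1) (E i))
    (hm : ∀ i j k, E i j k → IsMountain s (v i) j k) {p q : ↥(chainPoints c v ∪ {x})}
    (hne : p ≠ q) (hpq : ¬(fanGraph (chainPoints c v ∪ {x}) x v E).Adj p q) :
    IsCrossed (fanGraph (chainPoints c v ∪ {x}) x v E) p q := by
  have hp : (p : Plane) ∈ chainPoints c v := p.2.resolve_right fun e => hpq ⟨hne, Or.inl e⟩
  have hq : (q : Plane) ∈ chainPoints c v :=
    q.2.resolve_right fun e => hpq ⟨hne, Or.inr (Or.inl e)⟩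
  obtain ⟨i, j, hj, hp⟩ := hp
  obtain ⟨i', k, hk, hq⟩ := hq
  rcases fin3_cases i i' with rfl | rfl | rfl
  · have hjk : j ≠ k := by rintro rfl; exact hne (Subtype.ext (hp.trans hq.symm))
    rcases Nat.lt_or_gt_of_ne hjk with hlt | hlt
    · exact h.isCrossed_same hE hm hlt (by omega) hp hq fun he =>
        hpq ⟨hne, Or.inr (Or.inr (Or.inl ⟨_, _, _, he, hp, hq⟩))⟩
    · exact (h.isCrossed_same hE hm hlt (by omega) hq hp fun he =>
        hpq ⟨hne, Or.inr (Or.inr (Or.inr ⟨_, _, _, he, hq, hp⟩))⟩).symm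
  · exact h.isCrossed_next hs hX hE hm hj hk hp hq hpq
  · exact (h.isCrossed_next hs hX hE hm hk hj hq hp fun he => hpq he.symm).symm

theorem isTriangulation (h : IsFan s c x v) (hs : s ≠ 0)
    (hX : GeneralPosition (chainPoints c v ∪ {x}))
    (hE : ∀ i, IsTriangulatedPolygon (c i + 1) (E i))
    (hm : ∀ i j k, E i j k → IsMountain s (v i) j k) :
    IsTriangulation (fanGraph (chainPoints c v ∪ {x}) x v E) := by
  refine ⟨nonIntersecting_of_disjoint hX fun p q r t h1 h2 h3 h4 h5 h6 =>
    h.disjoint_of_adj hE hm h1 h2 h3 h4 h5 h6, fun T hT hle p q hpq => ?_⟩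
  by_contra hcon
  obtain ⟨r, t, hrt, h1, h2, h3, h4, z, hz, hz'⟩ := h.isCrossed_of_not_adj hs hX hE hm hpq.ne hcon
  have := hT p q r t hpq (hle hrt) (by simp [h1, h2]) ⟨hz, hz'⟩
  simp only [Set.mem_inter_iff, Set.mem_insert_iff, Set.mem_singleton_iff] at this
  have e1 := Subtype.coe_injective.ne h1
  have e2 := Subtype.coe_injective.ne h2
  have e3 := Subtype.coe_injective.ne h3
  have e4 := Subtype.coe_injective.ne h4
  obtain ⟨rfl | rfl, h6 | h6⟩ := this <;> contradiction

end IsFan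

/-! ### Triangulating a polygon -/

/-- Triangulations of the polygon with the vertices `j, …, k`, all of whose edges satisfy `M`. -/
lemma exists_triangulatedPolygon_aux (M : ℕ → ℕ → Prop)
    (hsplit : ∀ j k, j + 1 < k → M j k → ∃ l, j < l ∧ l < k ∧ M j l ∧ M l k) (d : ℕ) :
    ∀ j k, j < k → k - j ≤ d → M j k → ∃ E : ℕ → ℕ → Prop,
      E j k ∧ (∀ a b, E a b → j ≤ a ∧ a < b ∧ b ≤ k ∧ M a b) ∧
      (∀ a b l n, E a b → E l n → ¬(a < l ∧ l < b ∧ b < n)) ∧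
      ∀ a b, j ≤ a → a < b → b ≤ k → ¬E a b →
        ∃ l n, E l n ∧ ((a < l ∧ l < b ∧ b < n) ∨ (l < a ∧ a < n ∧ n < b)) := by
  induction d with
  | zero => intro j k h1 h2; omega
  | succ d ih =>
    intro j k hjk hd hM
    rcases (show j + 1 ≤ k from hjk).eq_or_lt with rfl | hlt
    · refine ⟨fun a b => a = j ∧ b = j + 1, ⟨rfl, rfl⟩, ?_, ?_, ?_⟩
      · rintro a b ⟨rfl, rfl⟩
        exact ⟨le_rfl, hjk, le_rfl, hM⟩
      · rintro a b l n ⟨rfl, rfl⟩ ⟨rfl, rfl⟩; omega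
      · intro a b h1 h2 h3 h4; exact absurd ⟨by omega, by omega⟩ h4
    · obtain ⟨m, h1, h2, hM1, hM2⟩ := hsplit j k hlt hM
      obtain ⟨E, e0, e1, e2, e3⟩ := ih j m h1 (by omega) hM1
      obtain ⟨F, f0, f1, f2, f3⟩ := ih m k h2 (by omega) hM2
      refine ⟨fun a b => (a = j ∧ b = k) ∨ E a b ∨ F a b, Or.inl ⟨rfl, rfl⟩, ?_, ?_, ?_⟩
      · rintro a b (⟨rfl, rfl⟩ | h | h)
        · exact ⟨le_rfl, hjk, le_rfl, hM⟩
        · have := e1 a b h; exact ⟨by omega, by omega, by omega, this.2.2.2⟩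
        · have := f1 a b h; exact ⟨by omega, by omega, by omega, this.2.2.2⟩
      · rintro a b l n (⟨rfl, rfl⟩ | h | h) (⟨rfl, rfl⟩ | h' | h')
        · omega
        · have := e1 _ _ h'; omega
        · have := f1 _ _ h'; omega
        · have := e1 _ _ h; omega
        · exact e2 _ _ _ _ h h'
        · have := e1 _ _ h; have := f1 _ _ h'; omega
        · have := f1 _ _ h; omega
        · have := f1 _ _ h; have := e1 _ _ h'; omega
        · exact f2 _ _ _ _ h h'
      · intro a b ha hab hb hn
        simp only [not_or] at hn
        rcases le_or_gt b m with hbm | hbm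
        · obtain ⟨l, n, hl, hc⟩ := e3 a b ha hab hbm hn.2.1
          exact ⟨l, n, Or.inr (Or.inl hl), hc⟩
        rcases le_or_gt m a with ham | ham
        · obtain ⟨l, n, hl, hc⟩ := f3 a b ham hab hb hn.2.2
          exact ⟨l, n, Or.inr (Or.inr hl), hc⟩
        -- A pair that straddles the apex `m` interleaves with one of the two other sides of the
        -- triangle, `(m, k)` or `(j, m)`.
        rcases ha.eq_or_lt with rfl | ha
        · have : b ≠ k := fun e => hn.1 ⟨rfl, e⟩
          exact ⟨m, k, Or.inr (Or.inr f0), by omega⟩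
        · exact ⟨j, m, Or.inr (Or.inl e0), by omega⟩

lemma exists_triangulatedPolygon (M : ℕ → ℕ → Prop) (m : ℕ) (hm : 0 < m) (h0 : M 0 m)
    (hsplit : ∀ j k, j + 1 < k → k ≤ m → M j k → ∃ l, j < l ∧ l < k ∧ M j l ∧ M l k) :
    ∃ E, IsTriangulatedPolygon m E ∧ ∀ j k, E j k → M j k := by
  obtain ⟨E, -, e1, e2, e3⟩ := exists_triangulatedPolygon_aux (fun j k => M j k ∧ k ≤ m)
    (fun j k h1 h2 => by
      obtain ⟨l, a, b, c, d⟩ := hsplit j k h1 h2.2 h2.1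
      exact ⟨l, a, b, ⟨c, by omega⟩, d, h2.2⟩) m 0 m hm (by omega) ⟨h0, le_rfl⟩
  exact ⟨E, ⟨fun j k h => (e1 j k h).2.1, fun j k h => (e1 j k h).2.2.1, e2,
    fun j k h1 h2 h3 => e3 j k (Nat.zero_le _) h1 h2 h3⟩, fun j k h => (e1 j k h).2.2.2.1⟩

/-- A chain in angular order around `x` that lies above its base line can be split there into two
such chains. -/
lemma IsMountain.exists_split {s : ℝ} {x : Plane} {w : ℕ → Plane} {m : ℕ}
    (hfan : ∀ j k, j < k → k ≤ m → 0 < so s x (w j) (w k))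
    (hgp : ∀ j k l, j < k → k < l → l ≤ m → so s (w j) (w k) (w l) ≠ 0) {j k : ℕ}
    (hjk : j + 1 < k) (hk : k ≤ m) (hM : IsMountain s w j k) :
    ∃ l, j < l ∧ l < k ∧ IsMountain s w j l ∧ IsMountain s w l k := by
  -- The splitting point makes the smallest angle at `w j` with the base line. It is found by a
  -- running minimum; comparison of angles is transitive because all candidates lie on one side of
  -- that line.
  have hmin : ∀ n, j + 1 < n → n ≤ k → ∃ l, j < l ∧ l < n ∧
      ∀ l', j < l' → l' < n → l' ≠ l → 0 < so s (w j) (w l) (w l') := by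
    intro n hn
    induction n, hn using Nat.le_induction with
    | base => intro _; exact ⟨j + 1, by omega, by omega, fun l' h1 h2 h3 => by omega⟩
    | succ n hn ih =>
      intro hnk
      obtain ⟨l, h1, h2, h3⟩ := ih (by omega)
      rcases lt_or_gt_of_ne (hgp j l n h1 h2 (by omega)) with hneg | hpos
      · refine ⟨n, by omega, by omega, fun l' h4 h5 h6 => ?_⟩
        have hl : 0 < so s (w j) (w n) (w l) := by rw [so_swap]; linarith
        rcases eq_or_ne l' l with rfl | hne
        · exact hl
        have a1 := hM n (by omega) (by omega)
        have a2 := hM l (by omega) (by omega)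
        have a3 := hM l' (by omega) (by omega)
        have a4 := h3 l' h4 (by omega) hne
        have hp := so_plucker s (w j) (w k) (w n) (w l) (w l')
        by_contra hc
        push Not at hc
        nlinarith [mul_pos a1 a4, mul_pos a3 hl, mul_nonneg a2.le (neg_nonneg.2 hc)]
      · refine ⟨l, h1, by omega, fun l' h4 h5 h6 => ?_⟩
        rcases eq_or_ne l' n with rfl | hne
        · exact hpos
        · exact h3 l' h4 (by omega) h6
  obtain ⟨l, h1, h2, h3⟩ := hmin k hjk le_rfl
  refine ⟨l, h1, h2, fun l' h4 h5 => h3 l' h4 (by omega) (by omega), fun l' h4 h5 => ?_⟩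
  have a1 := hM l h1 h2
  have a2 := h3 l' (by omega) h5 (by omega)
  have a3 := hfan j l h1 (by omega)
  have a4 := hfan l l' h4 (by omega)
  have a5 := hfan l k h2 hk
  have hp := so_plucker s (w l) (w j) (w k) (w l') x
  have e1 : so s (w l) (w j) (w k) = so s (w j) (w k) (w l) := so_rot ..
  have e2 : so s (w l) (w j) (w l') = -so s (w j) (w l) (w l') := so_swap_left ..
  have e3 : so s (w l) (w k) x = so s x (w l) (w k) := (so_rot ..).symm
  have e4 : so s (w l) (w l') x = so s x (w l) (w l') := (so_rot ..).symm
  have e5 : so s (w l) (w j) x = -so s x (w j) (w l) := by rw [← so_rot, so_swap]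
  rw [e1, e2, e3, e4, e5] at hp
  by_contra hc
  push Not at hc
  nlinarith [mul_pos a1 a4, mul_pos a2 a5, mul_nonneg a3.le (neg_nonneg.2 hc)]

/-! ### Compatible fans -/

/-- The index set of the points of a fan other than its center. -/
abbrev ChainIndex (c : Fin 3 → ℕ) : Type := Σ i : Fin 3, Fin (c i + 1)

/-- The point of a fan with a given index; `none` is the index of the center. -/
def fanPoint (c : Fin 3 → ℕ) (x : Plane) (v : Fin 3 → ℕ → Plane) : Option (ChainIndex c) → Plane
  | none => x
  | some a => v a.1 a.2

lemma range_fanPoint (c : Fin 3 → ℕ) (x : Plane) (v : Fin 3 → ℕ → Plane) :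
    Set.range (fanPoint c x v) = chainPoints c v ∪ {x} := by
  ext p
  constructor
  · rintro ⟨_ | ⟨i, j⟩, rfl⟩
    · exact Or.inr rfl
    · exact Or.inl ⟨i, j, by omega, rfl⟩
  · rintro (⟨i, j, hj, rfl⟩ | rfl)
    · exact ⟨some ⟨i, ⟨j, by omega⟩⟩, rfl⟩
    · exact ⟨none, rfl⟩

lemma IsFan.injective_fanPoint {s : ℝ} {c : Fin 3 → ℕ} {x : Plane} {v : Fin 3 → ℕ → Plane}
    (h : IsFan s c x v) : Function.Injective (fanPoint c x v) := by
  rintro (_ | ⟨i, j⟩) (_ | ⟨i', j'⟩) e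
  · rfl
  · exact absurd e.symm (h.ne_center (by omega))
  · exact absurd e (h.ne_center (by omega))
  · obtain ⟨rfl, e'⟩ := h.injective (by omega) (by omega) e
    obtain rfl : j = j' := Fin.ext e'
    rfl

/-- The points of a fan, indexed. -/
noncomputable def IsFan.equiv {s : ℝ} {c : Fin 3 → ℕ} {x : Plane} {v : Fin 3 → ℕ → Plane}
    (h : IsFan s c x v) : Option (ChainIndex c) ≃ ↥(chainPoints c v ∪ {x}) :=
  (Equiv.ofInjective _ h.injective_fanPoint).trans (Equiv.setCongr (range_fanPoint c x v))

lemma IsFan.coe_equiv {s : ℝ} {c : Fin 3 → ℕ} {x : Plane} {v : Fin 3 → ℕ → Plane}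
    (h : IsFan s c x v) (a : Option (ChainIndex c)) : (h.equiv a : Plane) = fanPoint c x v a := rfl

/-- Two fans with equally long chains, one of them with chains bent towards the center, have a
compatible triangulation. -/
theorem IsFan.exists_compatible {s t : ℝ} {c : Fin 3 → ℕ} {x y : Plane} {v w : Fin 3 → ℕ → Plane}
    (hv : IsFan s c x v) (hw : IsFan t c y w) (hs : s ≠ 0) (ht : t ≠ 0)
    (hX : GeneralPosition (chainPoints c v ∪ {x})) (hY : GeneralPosition (chainPoints c w ∪ {y}))
    (hmv : ∀ i j k, j < k → k ≤ c i + 1 → IsMountain s (v i) j k)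
    (hmw : ∀ i, IsMountain t (w i) 0 (c i + 1)) :
    ∃ f : ↥(chainPoints c v ∪ {x}) ≃ ↥(chainPoints c w ∪ {y}),
      (∀ (p : ↥(chainPoints c v ∪ {x})) (i : Fin 3), (p : Plane) = v i 0 →
        (f p : Plane) = w i 0) ∧
      ∃ T U, IsCompatibleTriangulation f T U := by
  have hsplit : ∀ i j k, j + 1 < k → k ≤ c i + 1 → IsMountain t (w i) j k →
      ∃ l, j < l ∧ l < k ∧ IsMountain t (w i) j l ∧ IsMountain t (w i) l k :=
    fun i j k h1 h2 => IsMountain.exists_split (hw.fan i) (fun a b d h3 h4 h5 =>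
      hY.so_ne_zero ht (Or.inl (hw.mem_chainPoints (by omega)))
        (Or.inl (hw.mem_chainPoints (by omega))) (Or.inl (hw.mem_chainPoints h5))
        (fun e => h3.ne (hw.injOn_chain (by omega) (by omega) e))
        (fun e => (h3.trans h4).ne (hw.injOn_chain (by omega) (by omega) e))
        (fun e => h4.ne (hw.injOn_chain (by omega) (by omega) e))) h1 h2
  -- The chords are chosen for `w`, the more restrictive side; by `hmv` the same index pairs can be
  -- drawn for `v`.
  choose E hE hEM using fun i => exists_triangulatedPolygon (IsMountain t (w i)) (c i + 1)
    (Nat.succ_pos _) (hmw i) (hsplit i)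
  have hf : ∀ i j, j ≤ c i + 1 → ∀ p : ↥(chainPoints c v ∪ {x}),
      ((p : Plane) = v i j ↔ ((hv.equiv.symm.trans hw.equiv) p : Plane) = w i j) := by
    intro i j hj p
    obtain ⟨a, rfl⟩ := hv.equiv.surjective p
    have key : ∃ b, fanPoint c x v b = v i j ∧ fanPoint c y w b = w i j := by
      rcases hj.lt_or_eq with hj | rfl
      · exact ⟨some ⟨i, ⟨j, hj⟩⟩, rfl, rfl⟩
      · exact ⟨some ⟨i + 1, ⟨0, Nat.succ_pos _⟩⟩, (hv.glue i).symm, (hw.glue i).symm⟩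
    obtain ⟨b, hb, hb'⟩ := key
    rw [Equiv.trans_apply, Equiv.symm_apply_apply, hv.coe_equiv, hw.coe_equiv, ← hb, ← hb',
      hv.injective_fanPoint.eq_iff, hw.injective_fanPoint.eq_iff]
  have hfx : ∀ p : ↥(chainPoints c v ∪ {x}),
      ((p : Plane) = x ↔ ((hv.equiv.symm.trans hw.equiv) p : Plane) = y) := by
    intro p
    obtain ⟨a, rfl⟩ := hv.equiv.surjective p
    rw [Equiv.trans_apply, Equiv.symm_apply_apply, hv.coe_equiv, hw.coe_equiv]
    exact (hv.injective_fanPoint.eq_iff (b := none)).trans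
      (hw.injective_fanPoint.eq_iff (b := none)).symm
  have hfE : ∀ p q : ↥(chainPoints c v ∪ {x}), IsChainEdge v E p q ↔
      IsChainEdge w E ((hv.equiv.symm.trans hw.equiv) p) ((hv.equiv.symm.trans hw.equiv) q) := by
    intro p q
    refine exists_congr fun i => exists_congr fun j => exists_congr fun k =>
      and_congr_right fun hjk => ?_
    have h1 := (hE i).lt _ _ hjk
    have h2 := (hE i).le _ _ hjk
    rw [← hf i j (by omega), ← hf i k h2]
  refine ⟨hv.equiv.symm.trans hw.equiv, fun p i hp => (hf i 0 (Nat.zero_le _) p).1 hp,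
    fanGraph _ x v E, fanGraph _ y w E, hv.isTriangulation hs hX hE fun i j k h =>
      hmv i j k ((hE i).lt _ _ h) ((hE i).le _ _ h), hw.isTriangulation ht hY hE hEM,
    fun p q => ?_⟩
  simp only [fanGraph, ne_eq, hfx, hfE, EmbeddingLike.apply_eq_iff_eq]

/-! ### Triangular convex hulls -/

lemma hull_subset (P : Set Plane) : hull P ⊆ P := extremePoints_convexHull_subset

/-- Krein–Milman; the closure can be dropped because there are finitely many extreme points. -/
lemma convexHull_hull {P : Set Plane} (hP : P.Finite) :
    convexHull ℝ (hull P) = convexHull ℝ P := by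
  have h := closure_convexHull_extremePoints (hP.isCompact_convexHull ℝ) (convex_convexHull ℝ P)
  change closure (convexHull ℝ (hull P)) = _ at h
  rwa [((hP.subset (hull_subset P)).isClosed_convexHull ℝ).closure_eq] at h

lemma hull_union_singleton {P : Set Plane} {x : Plane} (hx : x ∈ convexHull ℝ P) :
    hull (P ∪ {x}) = hull P := by
  have : convexHull ℝ (P ∪ {x}) = convexHull ℝ P := by
    refine (convexHull_min ?_ (convex_convexHull ℝ P)).antisymm
      (convexHull_mono Set.subset_union_left)
    exact Set.union_subset (subset_convexHull ℝ P) (by simpa using hx)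
  rw [hull, hull, this]

lemma fin3_ne_succ (i : Fin 3) : i ≠ i + 1 := by revert i; decide

lemma fin3_two_add_one (i : Fin 3) : i + 2 + 1 = i := by revert i; decide

/-- The points `C 0`, `C 1`, `C 2` of `P` span a triangle, of orientation `s`, that contains `P`,
without any further points of `P` on its sides. -/
structure IsFrame (s : ℝ) (C : Fin 3 → Plane) (P : Set Plane) : Prop where
  sign : s = 1 ∨ s = -1
  mem : ∀ i, C i ∈ P
  area : ∀ i, 0 < so s (C i) (C (i + 1)) (C (i + 2))
  pos : ∀ i, ∀ p ∈ P, p ≠ C i → p ≠ C (i + 1) → 0 < so s (C i) (C (i + 1)) p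

lemma IsFrame.sign_ne_zero {s : ℝ} {C : Fin 3 → Plane} {P : Set Plane} (h : IsFrame s C P) :
    s ≠ 0 := by
  rcases h.sign with rfl | rfl <;> norm_num

lemma so_triangle_rot (s : ℝ) (C : Fin 3 → Plane) (i : Fin 3) :
    so s (C i) (C (i + 1)) (C (i + 2)) = so s (C 0) (C 1) (C 2) := by
  fin_cases i
  · rfl
  · exact (so_rot ..).symm
  · exact so_rot ..

lemma exists_isFrame {P : Set Plane} (hfin : P.Finite) (hP : GeneralPosition P)
    {C : Fin 3 → Plane} (hC : Function.Injective C) (hhull : hull P = Set.range C) :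
    ∃ s, IsFrame s C P := by
  have hmem : ∀ i, C i ∈ P := fun i => hull_subset P (hhull ▸ ⟨i, rfl⟩)
  have hne := hP.so_ne_zero one_ne_zero (hmem 0) (hmem 1) (hmem 2) (hC.ne (by decide))
    (hC.ne (by decide)) (hC.ne (by decide))
  obtain ⟨s, hs, hpos⟩ : ∃ s : ℝ, (s = 1 ∨ s = -1) ∧ 0 < so s (C 0) (C 1) (C 2) := by
    rcases lt_or_gt_of_ne hne with h | h
    · exact ⟨-1, Or.inr rfl, by rw [so_neg]; linarith⟩
    · exact ⟨1, Or.inl rfl, h⟩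
  have hs0 : s ≠ 0 := by rcases hs with rfl | rfl <;> norm_num
  have harea : ∀ i, 0 < so s (C i) (C (i + 1)) (C (i + 2)) := fun i => by
    rw [so_triangle_rot]; exact hpos
  refine ⟨s, hs, hmem, harea, fun i p hp h1 h2 => ?_⟩
  have hnn : 0 ≤ so s (C i) (C (i + 1)) p := by
    have hsub : convexHull ℝ P ⊆ {r | 0 ≤ so s (C i) (C (i + 1)) r} := by
      rw [← convexHull_hull hfin, hhull]
      refine convexHull_min ?_ (convex_so_nonneg _ _ _)
      rintro _ ⟨j, rfl⟩
      rcases fin3_cases i j with rfl | rfl | rfl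
      · simp
      · simp
      · have := (harea (j + 1)).le
        rwa [fin3_add_two, fin3_add_three] at this
    exact hsub (subset_convexHull ℝ P hp)
  refine hnn.lt_of_ne (Ne.symm (hP.so_ne_zero hs0 (hmem i) (hmem _) hp (hC.ne (fin3_ne_succ i)) h1.symm
    h2.symm))

namespace IsFrame

variable {s : ℝ} {C : Fin 3 → Plane} {P : Set Plane}

/-- The three areas spanned by `p` and the sides add up to the area of the triangle, and the other
two are not both zero. -/
lemma corner (h : IsFrame s C P) (i : Fin 3) {p : Plane} (hp : p ∈ P) (hpi : p ≠ C i) :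
    so s (C (i + 1)) (C (i + 2)) p < so s (C (i + 1)) (C (i + 2)) (C i) := by
  have hsum := so_sum s (C i) (C (i + 1)) (C (i + 2)) p
  have e : so s (C (i + 1)) (C (i + 2)) (C i) = so s (C i) (C (i + 1)) (C (i + 2)) :=
    (so_rot ..).symm
  by_cases h1 : p = C (i + 1)
  · subst h1
    have := h.area i
    rw [e]; simpa using this
  have h2 := h.pos i p hp hpi h1
  have h3 : 0 ≤ so s (C (i + 2)) (C i) p := by
    by_cases h4 : p = C (i + 2)
    · simp [h4]
    · have := h.pos (i + 2) p hp h4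
      rw [fin3_two_add_one] at this
      exact (this hpi).le
  linarith

lemma corner_of_pos {x : Plane} (hx : ∀ i, 0 < so s (C i) (C (i + 1)) x) (i : Fin 3) :
    so s (C (i + 1)) (C (i + 2)) x < so s (C (i + 1)) (C (i + 2)) (C i) := by
  have hsum := so_sum s (C i) (C (i + 1)) (C (i + 2)) x
  have e : so s (C (i + 1)) (C (i + 2)) (C i) = so s (C i) (C (i + 1)) (C (i + 2)) :=
    (so_rot ..).symm
  have h1 := hx i
  have h3 := hx (i + 2)
  rw [fin3_two_add_one] at h3
  linarith

/-- The point with given (not normalized) barycentric coordinates. -/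
lemma exists_point (h : IsFrame s C P) (w : Fin 3 → ℝ) (hw : ∀ i, 0 < w i) :
    ∃ x, ∃ κ > 0, ∀ i, so s (C i) (C (i + 1)) x = κ * w i := by
  have hA := h.area 0
  simp only [zero_add] at hA
  have h0 := hw 0
  have h1 := hw 1
  have h2 := hw 2
  have hW : 0 < w 0 + w 1 + w 2 := by positivity
  -- The index shift arises because side `i` is opposite to the vertex `C (i + 2)`.
  refine ⟨(w 1 / (w 0 + w 1 + w 2)) • C 0 + (w 2 / (w 0 + w 1 + w 2)) • C 1 +
    (w 0 / (w 0 + w 1 + w 2)) • C 2, so s (C 0) (C 1) (C 2) / (w 0 + w 1 + w 2), by positivity, ?_⟩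
  intro i
  fin_cases i <;>
  · simp only [so, orient, PiLp.add_apply, PiLp.smul_apply, smul_eq_mul, Fin.zero_eta, Fin.mk_one,
      Fin.reduceFinMk, Fin.isValue, zero_add, Fin.reduceAdd]
    field_simp
    ring

lemma mem_convexHull (h : IsFrame s C P) {x : Plane} (hx : ∀ i, 0 < so s (C i) (C (i + 1)) x) :
    x ∈ convexHull ℝ P := by
  have hA := h.area 0
  simp only [zero_add] at hA
  have hsum := so_sum s (C 0) (C 1) (C 2) x
  have h0 := hx 0
  have h1 := hx 1
  have h2 := hx 2
  simp only [zero_add, Fin.isValue, Fin.reduceAdd] at h0 h1 h2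
  have key : (so s (C 1) (C 2) x / so s (C 0) (C 1) (C 2)) • C 0 +
      (so s (C 2) (C 0) x / so s (C 0) (C 1) (C 2)) • C 1 +
      (so s (C 0) (C 1) x / so s (C 0) (C 1) (C 2)) • C 2 = x := by
    apply plane_ext <;>
    · simp only [PiLp.add_apply, PiLp.smul_apply, smul_eq_mul]
      field_simp
      simp only [so, orient]; ring
  have := (convex_convexHull ℝ P).sum_mem (t := Finset.univ)
    (w := ![so s (C 1) (C 2) x / so s (C 0) (C 1) (C 2),
      so s (C 2) (C 0) x / so s (C 0) (C 1) (C 2), so s (C 0) (C 1) x / so s (C 0) (C 1) (C 2)])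
    (z := C) ?_ ?_ fun i _ => subset_convexHull ℝ P (h.mem i)
  · simp only [Fin.sum_univ_three, Matrix.cons_val] at this
    rwa [key] at this
  · intro i _
    fin_cases i <;> simp <;> positivity
  · simp only [Fin.sum_univ_three, Matrix.cons_val]
    field_simp
    linarith

end IsFrame

/-! ### Points in general position -/

lemma dense_so_ne_zero {p q : Plane} (hpq : p ≠ q) : Dense {x | so 1 p q x ≠ 0} := by
  obtain ⟨z, hz⟩ : ∃ z, so 1 p q z ≠ 0 := by
    -- This is `p` plus `q - p` rotated by a right angle; the area is then the squared length of `q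
    -- - p`.
    refine ⟨!₂[p 0 - (q 1 - p 1), p 1 + (q 0 - p 0)], fun h => hpq ?_⟩
    simp only [so, orient, Matrix.cons_val_zero, Matrix.cons_val_one] at h
    refine plane_ext ?_ ?_ <;>
      nlinarith [sq_nonneg (q 0 - p 0), sq_nonneg (q 1 - p 1)]
  intro x
  by_cases hx : so 1 p q x = 0
  · have hlim : Filter.Tendsto (fun t : ℝ => (1 - t) • x + t • z) (nhdsWithin 0 {0}ᶜ) (nhds x) := by
      have : Continuous fun t : ℝ => (1 - t) • x + t • z := by fun_prop
      have := this.tendsto 0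
      simp only [sub_zero, one_smul, zero_smul, add_zero] at this
      exact this.mono_left nhdsWithin_le_nhds
    refine mem_closure_of_tendsto hlim ?_
    filter_upwards [self_mem_nhdsWithin] with t ht
    rw [so_combination _ _ _ _ _ (by ring), hx, mul_zero, zero_add]
    exact mul_ne_zero ht hz
  · exact subset_closure hx

lemma exists_mem_open_so_ne_zero {P : Set Plane} (hP : P.Finite) {U : Set Plane} (hU : IsOpen U)
    (hne : U.Nonempty) : ∃ x ∈ U, ∀ p ∈ P, ∀ q ∈ P, p ≠ q → so 1 p q x ≠ 0 := by
  have hd : Dense (⋂ a ∈ {a : Plane × Plane | a ∈ P ×ˢ P ∧ a.1 ≠ a.2},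
      {x | so 1 a.1 a.2 x ≠ 0}) := by
    refine dense_biInter_of_isOpen (fun a _ => ?_) ?_ fun a ha => dense_so_ne_zero ha.2
    · exact isOpen_ne.preimage (continuous_so 1 a.1 a.2)
    · exact ((hP.prod hP).subset fun a ha => ha.1).countable
  obtain ⟨x, hx, hx'⟩ := hd.inter_open_nonempty U hU hne
  refine ⟨x, hx, fun p hp q hq hpq => ?_⟩
  exact Set.mem_iInter₂.1 hx' (p, q) ⟨⟨hp, hq⟩, hpq⟩

lemma GeneralPosition.union_singleton {P : Set Plane} (hP : GeneralPosition P) {x : Plane}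
    (hx : ∀ p ∈ P, ∀ q ∈ P, p ≠ q → so 1 p q x ≠ 0) : GeneralPosition (P ∪ {x}) := by
  have key : ∀ p ∈ P, ∀ q ∈ P, p ≠ q → ¬Collinear ℝ {p, q, x} := by
    intro p hp q hq hpq h
    rw [collinear_iff_orient hpq] at h
    exact hx p hp q hq hpq (by rw [so, h, mul_zero])
  rintro p (hp | rfl) q (hq | rfl) r (hr | rfl) h1 h2 h3
  · exact hP p hp q hq r hr h1 h2 h3
  · exact key p hp q hq h1
  · have := key p hp r hr h2
    rwa [Set.pair_comm] at this
  · exact absurd rfl h3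
  · have := key q hq r hr h3
    rwa [Set.pair_comm, Set.insert_comm] at this
  all_goals exact absurd rfl ‹_›

/-! ### Unavoidable edges -/

/-- The single edge `p q` extends to some triangulation, and that triangulation also contains `a b`.
-/
lemma IsUnavoidableEdge.disjoint {P : Set Plane} (hP : P.Finite) {a b : Plane}
    (h : IsUnavoidableEdge P a b) {p q : Plane} (hp : p ∈ P) (hq : q ∈ P) (hpq : p ≠ q)
    (hpa : p ≠ a) (hpb : p ≠ b) :
    segment ℝ p q ∩ segment ℝ a b ⊆ {q} := by
  obtain ⟨ha, hb, hT⟩ := h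
  have : Finite P := hP
  have hne : (⟨p, hp⟩ : P) ≠ ⟨q, hq⟩ := fun e => hpq (Subtype.ext_iff.1 e)
  have h0 : NonIntersecting (SimpleGraph.edge (⟨p, hp⟩ : P) ⟨q, hq⟩) := by
    intro a b c d hab hcd hne
    refine absurd ?_ hne
    rw [SimpleGraph.edge_adj] at hab hcd
    have h1 : s(a, b) = s((⟨p, hp⟩ : P), ⟨q, hq⟩) := by
      rcases hab.1 with ⟨rfl, rfl⟩ | ⟨rfl, rfl⟩
      · rfl
      · exact Sym2.eq_swap
    have h2 : s(c, d) = s((⟨p, hp⟩ : P), ⟨q, hq⟩) := by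
      rcases hcd.1 with ⟨rfl, rfl⟩ | ⟨rfl, rfl⟩
      · rfl
      · exact Sym2.eq_swap
    rw [h1, h2]
  obtain ⟨T, hle, hmax⟩ := Finite.exists_le_maximal h0
  have h1 : T.Adj ⟨p, hp⟩ ⟨q, hq⟩ := hle (by rw [SimpleGraph.edge_adj]; exact ⟨by simp, hne⟩)
  have := hmax.1 _ _ _ _ h1 (hT T hmax) (by simp [hpa, hpb])
  refine this.trans ?_
  rintro z ⟨hz, hz'⟩
  rcases hz with rfl | hz
  · rcases hz' with rfl | rfl <;> contradiction
  · exact hz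

/-! ### Pockets bounded by uncrossed convex chains -/

/-- The chain `w 0, …, w m` bounds a convex polygon along the side `w 0`, `w m` of a triangle with
the third vertex `D`, and no segment between points of `P` crosses it. -/
structure IsPocket (s : ℝ) (P : Set Plane) (w : ℕ → Plane) (m : ℕ) (D : Plane) : Prop where
  sign : s ≠ 0
  gp : GeneralPosition P
  mem : ∀ j ≤ m, w j ∈ P
  mem_apex : D ∈ P
  inj : ∀ j k, j ≤ m → k ≤ m → w j = w k → j = k
  ne_apex : ∀ j ≤ m, w j ≠ D
  bend : ∀ j k l, j < k → k < l → l ≤ m → so s (w j) (w k) (w l) < 0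
  apex : ∀ p ∈ P, p ≠ D → so s (w 0) (w m) p < so s (w 0) (w m) D
  base : ∀ p ∈ P, p ≠ w 0 → p ≠ w m → 0 < so s (w 0) (w m) p
  left : ∀ p ∈ P, p ≠ D → p ≠ w 0 → 0 < so s D (w 0) p
  right : ∀ p ∈ P, p ≠ w m → p ≠ D → 0 < so s (w m) D p
  uncrossed : ∀ k < m, ∀ p ∈ P, ∀ q ∈ P, p ≠ q → p ≠ w k → p ≠ w (k + 1) → q ≠ w k →
    q ≠ w (k + 1) → segment ℝ p q ∩ segment ℝ (w k) (w (k + 1)) = ∅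

namespace IsPocket

variable {s : ℝ} {P : Set Plane} {w : ℕ → Plane} {m : ℕ} {D : Plane}

lemma reverse (h : IsPocket s P w m D) : IsPocket (-s) P (fun j => w (m - j)) m D where
  sign := neg_ne_zero.2 h.sign
  gp := h.gp
  mem j _ := h.mem _ (by omega)
  mem_apex := h.mem_apex
  inj j k hj hk e := by have := h.inj _ _ (by omega) (by omega) e; omega
  ne_apex j _ := h.ne_apex _ (by omega)
  bend j k l h1 h2 h3 := by
    have := h.bend (m - l) (m - k) (m - j) (by omega) (by omega) (by omega)
    rw [so_neg, ← so_swap, so_rot]; exact this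
  apex p hp hpD := by
    simp only [Nat.sub_zero, Nat.sub_self, so_neg, ← so_swap_left]
    exact h.apex p hp hpD
  base p hp h1 h2 := by
    simp only [Nat.sub_zero, Nat.sub_self, so_neg, ← so_swap_left] at *
    exact h.base p hp h2 h1
  left p hp h1 h2 := by
    simp only [Nat.sub_zero, so_neg, ← so_swap_left] at *
    exact h.right p hp h2 h1
  right p hp h1 h2 := by
    simp only [Nat.sub_self, so_neg, ← so_swap_left] at *
    exact h.left p hp h2 h1
  uncrossed k hk p hp q hq hpq h1 h2 h3 h4 := by
    have e : m - k = m - (k + 1) + 1 := by omega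
    rw [segment_symm ℝ (w (m - k)), e]
    rw [e] at h1 h3
    exact h.uncrossed _ (by omega) p hp q hq hpq h2 h1 h4 h3

lemma so_chain_ne_zero (h : IsPocket s P w m D) {j k : ℕ} (hjk : j < k) (hk : k ≤ m) {p : Plane}
    (hp : p ∈ P) (hpw : ∀ j ≤ m, p ≠ w j) : so s (w j) (w k) p ≠ 0 :=
  h.gp.so_ne_zero h.sign (h.mem _ (by omega)) (h.mem _ hk) hp
    (fun e => hjk.ne (h.inj _ _ (by omega) hk e)) (hpw _ (by omega)).symm (hpw _ hk).symm

lemma so_chain_nonpos (h : IsPocket s P w m D) {j k : ℕ} (hj : j < m) (hk : k ≤ m) :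
    so s (w j) (w (j + 1)) (w k) ≤ 0 := by
  rcases lt_trichotomy k j with h1 | rfl | h1
  · rw [← so_rot]; exact (h.bend _ _ _ h1 (Nat.lt_succ_self _) hj).le
  · simp
  rcases (show j + 1 ≤ k from h1).eq_or_lt with rfl | h2
  · simp
  · exact (h.bend _ _ _ (Nat.lt_succ_self _) h2 hk).le

/-- No further point of `P` lies in the polygon bounded by the chain. -/
lemma not_below (h : IsPocket s P w m D) (hm : 0 < m) {p : Plane} (hp : p ∈ P)
    (hpw : ∀ j ≤ m, p ≠ w j) : ¬∀ j < m, so s (w j) (w (j + 1)) p < 0 := by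
  intro hneg
  by_cases hpD : p = D
  · subst hpD
    have h1 := h.left (w 1) (h.mem 1 hm) (h.ne_apex 1 hm) fun e => by
      have := h.inj _ _ hm (Nat.zero_le _) e; omega
    rw [so_rot] at h1
    linarith [hneg 0 hm]
  have h0 : 0 < so s p D (w 0) := by
    rw [so_rot]; exact h.left p hp hpD (hpw 0 (Nat.zero_le _))
  have hmm : so s p D (w m) < 0 := by
    have := h.right p hp (hpw m le_rfl) hpD
    have e := so_swap_left s (w m) D p
    rw [so_rot]
    linarith
  -- The ends of the chain lie on different sides of the line `p D`, so some edge of the chain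
  -- passes from one side to the other. The segment `p D` must not cross that edge.
  obtain ⟨j, hj, h1, h2⟩ : ∃ j < m, 0 < so s p D (w j) ∧ so s p D (w (j + 1)) ≤ 0 := by
    by_contra hcon
    push Not at hcon
    have : ∀ j ≤ m, 0 < so s p D (w j) := by
      intro j
      induction j with
      | zero => intro _; exact h0
      | succ j ih => intro hj; exact hcon j hj (ih (by omega))
    linarith [this m le_rfl]
  have h2' : so s p D (w (j + 1)) < 0 := h2.lt_of_ne
    (h.gp.so_ne_zero h.sign hp h.mem_apex (h.mem _ hj) hpD (hpw _ hj) (h.ne_apex _ hj).symm)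
  have h3 := hneg j hj
  by_cases hD : 0 < so s (w j) (w (j + 1)) D
  · obtain ⟨z, hz, hz'⟩ := exists_mem_segment_inter h1 h2 h3 hD
    have := h.uncrossed j hj p hp D h.mem_apex hpD (hpw _ (by omega)) (hpw _ hj)
      (h.ne_apex _ (by omega)).symm (h.ne_apex _ hj).symm
    exact (this ▸ ⟨hz, hz'⟩ : z ∈ (∅ : Set Plane))
  -- Otherwise `D` would lie in the triangle `p`, `w (j + 1)`, `w j`, although it is strictly higher
  -- over the base than all three.
  · have hbar := so_barycentric s p (w (j + 1)) (w j) (w 0) (w m) D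
    have hsum := so_sum s p (w (j + 1)) (w j) D
    have e1 : so s D (w (j + 1)) (w j) = -so s (w j) (w (j + 1)) D := by rw [so_swap, so_rot]
    have e2 : so s p (w (j + 1)) D = -so s p D (w (j + 1)) := so_swap ..
    have e3 : so s (w (j + 1)) (w j) D = -so s (w j) (w (j + 1)) D := so_swap_left ..
    have e4 : so s (w j) p D = so s p D (w j) := so_rot ..
    rw [e1, e2] at hbar
    rw [e2, e3, e4] at hsum
    have f1 := h.apex p hp hpD
    have f2 := h.apex (w j) (h.mem _ (by omega)) (h.ne_apex _ (by omega))
    have f3 := h.apex (w (j + 1)) (h.mem _ hj) (h.ne_apex _ hj)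
    have key : -so s (w j) (w (j + 1)) D * (so s (w 0) (w m) D - so s (w 0) (w m) p) +
        so s p D (w j) * (so s (w 0) (w m) D - so s (w 0) (w m) (w (j + 1))) +
        -so s p D (w (j + 1)) * (so s (w 0) (w m) D - so s (w 0) (w m) (w j)) = 0 := by
      linear_combination hbar + so s (w 0) (w m) D * hsum
    linarith [mul_nonneg (show 0 ≤ -so s (w j) (w (j + 1)) D by linarith) (sub_pos.2 f1).le,
      mul_pos h1 (sub_pos.2 f3), mul_pos (neg_pos.2 h2') (sub_pos.2 f2)]

/-- If this failed, `p` would either lie in the triangle `w 0`, `w k`, `w (k + 1)` and hence in the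
polygon, or be joined to `w 0` by a segment crossing the edge from `w k` to `w (k + 1)`. -/
lemma chord_step (h : IsPocket s P w m D) {k : ℕ} (hk0 : 0 < k) (hk : k < m) {p : Plane}
    (hp : p ∈ P) (hpw : ∀ j ≤ m, p ≠ w j) (hQ : 0 < so s (w 0) (w (k + 1)) p) :
    0 < so s (w 0) (w k) p := by
  by_contra hcon
  have hneg : so s (w 0) (w k) p < 0 :=
    (not_lt.1 hcon).lt_of_ne (h.so_chain_ne_zero hk0 hk.le hp hpw)
  have hbend := h.bend 0 k (k + 1) hk0 (Nat.lt_succ_self _) hk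
  rcases lt_or_gt_of_ne (h.so_chain_ne_zero (Nat.lt_succ_self k) hk hp hpw) with h1 | h1
  · refine h.not_below (by omega) hp hpw fun j hj => ?_
    refine lt_of_le_of_ne ?_ (h.so_chain_ne_zero (Nat.lt_succ_self j) hj hp hpw)
    have hbar := so_barycentric s (w 0) (w k) (w (k + 1)) (w j) (w (j + 1)) p
    have e1 : so s p (w k) (w (k + 1)) = so s (w k) (w (k + 1)) p := so_rot ..
    have e2 : so s (w 0) p (w (k + 1)) = -so s (w 0) (w (k + 1)) p := so_swap ..
    rw [e1, e2] at hbar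
    have f1 := h.so_chain_nonpos hj (Nat.zero_le m)
    have f2 := h.so_chain_nonpos hj hk.le
    have f3 := h.so_chain_nonpos hj (show k + 1 ≤ m from hk)
    by_contra hc
    push Not at hc
    nlinarith [mul_pos (neg_pos.2 hbend) hc, mul_nonneg (neg_pos.2 h1).le (neg_nonneg.2 f1),
      mul_nonneg hQ.le (neg_nonneg.2 f2), mul_nonneg (neg_pos.2 hneg).le (neg_nonneg.2 f3)]
  · obtain ⟨z, hz, hz'⟩ := exists_mem_segment_inter (s := s) (a := w k) (b := w (k + 1)) (c := p)
      (d := w 0) h1 (by rw [← so_rot]; exact hbend.le) (by rw [so_rot]; exact hneg)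
      (by rw [so_rot]; exact hQ)
    have := h.uncrossed k hk p hp (w 0) (h.mem 0 (by omega)) (hpw 0 (by omega))
      (hpw _ hk.le) (hpw _ hk) (fun e => hk0.ne (h.inj _ _ (by omega) hk.le e))
      (fun e => by have := h.inj _ _ (by omega) hk e; omega)
    exact (this ▸ ⟨hz', hz⟩ : z ∈ (∅ : Set Plane))

lemma chord (h : IsPocket s P w m D) {p : Plane} (hp : p ∈ P) (hpw : ∀ j ≤ m, p ≠ w j) {k : ℕ}
    (hk0 : 0 < k) (hk : k ≤ m) : 0 < so s (w 0) (w k) p := by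
  induction hk using Nat.decreasingInduction with
  | self => exact h.base p hp (hpw 0 (by omega)) (hpw m le_rfl)
  | of_succ k hk ih => exact h.chord_step hk0 hk hp hpw (ih (by omega))

/-- All further points of `P` lie on the inner side of the lines spanned by the edges of the
chain. -/
lemma above (h : IsPocket s P w m D) {p : Plane} (hp : p ∈ P) (hpw : ∀ j ≤ m, p ≠ w j) {k : ℕ}
    (hk : k < m) : 0 < so s (w k) (w (k + 1)) p := by
  have hrev : ∀ j < m, 0 < so s (w j) (w m) p := fun j hj => by
    have := h.reverse.chord hp (fun i _ => hpw _ (by omega)) (k := m - j) (by omega) (by omega)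
    simp only [Nat.sub_zero, show m - (m - j) = j by omega, so_neg, ← so_swap_left] at this
    exact this
  rcases Nat.eq_zero_or_pos k with rfl | hk0
  · exact h.chord hp hpw Nat.one_pos hk
  rcases (show k + 1 ≤ m from hk).eq_or_lt with rfl | hkm
  · exact hrev k hk
  have a1 := h.chord hp hpw hk0 hk.le
  have a2 := hrev k hk
  have b1 := h.bend 0 k (k + 1) hk0 (Nat.lt_succ_self _) hk
  have b2 := h.bend 0 k m hk0 hk le_rfl
  have b3 := h.bend k (k + 1) m (Nat.lt_succ_self _) hkm le_rfl
  -- The point `p` lies in the cone opposite to the angle of `w 0`, `w k`, `w m`. By convexity this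
  -- cone is on the inner side of the edge.
  have hp := so_plucker s (w k) (w 0) (w (k + 1)) (w m) p
  rw [so_swap_left s (w 0) (w k) (w (k + 1)), so_swap_left s (w 0) (w k) (w m),
    so_swap_left s (w 0) (w k) p] at hp
  by_contra hc
  push Not at hc
  nlinarith [mul_pos (neg_pos.2 b1) a2, mul_nonneg (neg_pos.2 b2).le (neg_nonneg.2 hc),
    mul_pos a1 (neg_pos.2 b3)]

end IsPocket

/-! ### Double circles are fans -/

/-- The combinatorial data of a generalized double circle, with a sign that fixes its
orientation. -/
structure IsDoubleCircle (s : ℝ) (c : Fin 3 → ℕ) (V : Fin 3 → ℕ → Plane) : Prop where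
  gp : GeneralPosition (chainPoints c V)
  frame : IsFrame s (fun i => V i 0) (chainPoints c V)
  one_le : ∀ i, 0 < c i
  glue : ∀ i, V i (c i + 1) = V (i + 1) 0
  inj : Function.Injective fun a : ChainIndex c => V a.1 a.2
  bend : ∀ i j k l, j < k → k < l → l ≤ c i + 1 → so s (V i j) (V i k) (V i l) < 0
  unavoidable : ∀ i, ∀ j ≤ c i, IsUnavoidableEdge (chainPoints c V) (V i j) (V i (j + 1))

lemma finite_chainPoints (c : Fin 3 → ℕ) (V : Fin 3 → ℕ → Plane) : (chainPoints c V).Finite := by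
  refine (Set.finite_range fun a : ChainIndex c => V a.1 a.2).subset ?_
  rintro p ⟨i, j, hj, rfl⟩
  exact ⟨⟨i, ⟨j, by omega⟩⟩, rfl⟩

lemma fin3_ne_add_two (i : Fin 3) : i ≠ i + 2 := by revert i; decide

lemma fin3_succ_ne_add_two (i : Fin 3) : i + 1 ≠ i + 2 := by revert i; decide

lemma fin3_add_two_add_two (i : Fin 3) : i + 2 + 2 = i + 1 := by revert i; decide

namespace IsDoubleCircle

variable {s : ℝ} {c : Fin 3 → ℕ} {V : Fin 3 → ℕ → Plane}

lemma eq_of_eq (h : IsDoubleCircle s c V) {i i' : Fin 3} {j j' : ℕ} (hj : j ≤ c i)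
    (hj' : j' ≤ c i') (e : V i j = V i' j') : i = i' ∧ j = j' := by
  have := @h.inj ⟨i, ⟨j, by omega⟩⟩ ⟨i', ⟨j', by omega⟩⟩ e
  simp only [Sigma.mk.injEq] at this
  obtain ⟨rfl, h2⟩ := this
  exact ⟨rfl, by simpa using h2⟩

lemma mem (h : IsDoubleCircle s c V) {i : Fin 3} {j : ℕ} (hj : j ≤ c i + 1) :
    V i j ∈ chainPoints c V := by
  rcases hj.lt_or_eq with hj | rfl
  · exact ⟨i, j, by omega, rfl⟩
  · exact ⟨i + 1, 0, by omega, h.glue i⟩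

lemma injOn_chain (h : IsDoubleCircle s c V) {i : Fin 3} {j k : ℕ} (hj : j ≤ c i + 1)
    (hk : k ≤ c i + 1) (e : V i j = V i k) : j = k := by
  rcases hj.lt_or_eq with hj | rfl <;> rcases hk.lt_or_eq with hk | rfl
  · exact (h.eq_of_eq (by omega) (by omega) e).2
  · rw [h.glue] at e
    exact absurd (h.eq_of_eq (by omega) (by omega) e).1 (fin3_ne_succ i)
  · rw [h.glue] at e
    exact absurd (h.eq_of_eq (by omega) (by omega) e).1.symm (fin3_ne_succ i)
  · rfl

lemma isPocket (h : IsDoubleCircle s c V) (i : Fin 3) :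
    IsPocket s (chainPoints c V) (V i) (c i + 1) (V (i + 2) 0) where
  sign := h.frame.sign_ne_zero
  gp := h.gp
  mem j hj := h.mem hj
  mem_apex := h.mem (by omega)
  inj j k hj hk e := h.injOn_chain hj hk e
  ne_apex j hj e := by
    rcases hj.lt_or_eq with hj | rfl
    · exact fin3_ne_add_two i (h.eq_of_eq (by omega) (by omega) e).1
    · rw [h.glue] at e
      exact fin3_succ_ne_add_two i (h.eq_of_eq (by omega) (by omega) e).1
  bend j k l h1 h2 h3 := h.bend i j k l h1 h2 h3
  apex p hp hpD := by
    have := h.frame.corner (i + 2) hp hpD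
    simp only [fin3_two_add_one, fin3_add_two_add_two] at this
    rw [h.glue]; exact this
  base p hp h1 h2 := by
    rw [h.glue] at *
    exact h.frame.pos i p hp h1 h2
  left p hp h1 h2 := by
    have := h.frame.pos (i + 2) p hp h1
    simp only [fin3_two_add_one] at this
    exact this h2
  right p hp h1 h2 := by
    rw [h.glue] at *
    have := h.frame.pos (i + 1) p hp h1
    simp only [← fin3_add_two] at this
    exact this h2
  uncrossed k hk p hp q hq hpq h1 h2 h3 h4 := by
    have hu := h.unavoidable i k (by omega)
    have hfin := finite_chainPoints c V
    have a1 := hu.disjoint hfin hp hq hpq h1 h2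
    have a2 := hu.disjoint hfin hq hp hpq.symm h3 h4
    rw [segment_symm] at a2
    ext z
    simp only [Set.mem_empty_iff_false, iff_false]
    intro hz
    exact hpq ((a2 hz).symm.trans (a1 hz))

/-- The condition `0 < j'` excludes the corners, each of which belongs to two chains. -/
lemma above (h : IsDoubleCircle s c V) {i i' : Fin 3} {j j' : ℕ} (hj : j ≤ c i) (hj' : j' ≤ c i')
    (hj0 : 0 < j') (hne : i' ≠ i) : 0 < so s (V i j) (V i (j + 1)) (V i' j') := by
  refine (h.isPocket i).above (h.mem (by omega)) (fun k hk e => ?_) (by omega)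
  rcases hk.lt_or_eq with hk | rfl
  · exact hne (h.eq_of_eq hj' (by omega) e).1
  · rw [h.glue] at e
    have := (h.eq_of_eq hj' (by omega) e).2
    omega

/-- The index of an inner point of the chain that is an endpoint of the `j`-th edge. -/
lemma exists_inner_endpoint (h : IsDoubleCircle s c V) (i : Fin 3) {j : ℕ} (hj : j ≤ c i) :
    ∃ k ≤ c i, 0 < k ∧ so s (V i j) (V i (j + 1)) (V i k) = 0 := by
  rcases Nat.eq_zero_or_pos j with rfl | hj0
  · exact ⟨1, h.one_le i, Nat.one_pos, by simp⟩
  · exact ⟨j, hj, hj0, by simp⟩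

/-- Some point is on the inner side of the lines spanned by any three edges of the chains. -/
lemma exists_above_three (h : IsDoubleCircle s c V) (a b d : ChainIndex c) :
    ∃ x, ∀ e : ChainIndex c, e = a ∨ e = b ∨ e = d →
      0 < so s (V e.1 e.2) (V e.1 (e.2 + 1)) x := by
  by_cases hcov : ∃ i, i ≠ a.1 ∧ i ≠ b.1 ∧ i ≠ d.1
  · obtain ⟨i, h1, h2, h3⟩ := hcov
    -- An inner point of a chain containing none of the three edges is strictly inside for all of
    -- them.
    refine ⟨V i 1, ?_⟩
    rintro e (rfl | rfl | rfl)
    all_goals exact h.above (by omega) (h.one_le i) Nat.one_pos (by assumption)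
  · have hd : a.1 ≠ b.1 ∧ a.1 ≠ d.1 ∧ b.1 ≠ d.1 := by
      revert hcov
      generalize a.1 = i; generalize b.1 = j; generalize d.1 = k
      revert i j k; decide
    -- The edges now lie on three different chains. The centroid of one inner endpoint of each
    -- works: every endpoint is on its own line and strictly inside for the other two.
    obtain ⟨j, hj, hj0, ej⟩ := h.exists_inner_endpoint a.1 (show (a.2 : ℕ) ≤ c a.1 by omega)
    obtain ⟨k, hk, hk0, ek⟩ := h.exists_inner_endpoint b.1 (show (b.2 : ℕ) ≤ c b.1 by omega)
    obtain ⟨l, hl, hl0, el⟩ := h.exists_inner_endpoint d.1 (show (d.2 : ℕ) ≤ c d.1 by omega)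
    have hcomb : ∀ u w : Plane, so s u w ((2/3 : ℝ) • ((1/2 : ℝ) • V a.1 j + (1/2 : ℝ) • V b.1 k) +
        (1/3 : ℝ) • V d.1 l) =
        (so s u w (V a.1 j) + so s u w (V b.1 k) + so s u w (V d.1 l)) / 3 := by
      intro u w
      rw [so_combination _ _ _ _ _ (by norm_num), so_combination _ _ _ _ _ (by norm_num)]
      ring
    refine ⟨(2/3 : ℝ) • ((1/2 : ℝ) • V a.1 j + (1/2 : ℝ) • V b.1 k) + (1/3 : ℝ) • V d.1 l,
      fun e he => ?_⟩
    rw [hcomb]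
    rcases he with rfl | rfl | rfl
    · have h1 := h.above (show (e.2 : ℕ) ≤ c e.1 by omega) hk hk0 hd.1.symm
      have h2 := h.above (show (e.2 : ℕ) ≤ c e.1 by omega) hl hl0 hd.2.1.symm
      linarith
    · have h1 := h.above (show (e.2 : ℕ) ≤ c e.1 by omega) hj hj0 hd.1
      have h2 := h.above (show (e.2 : ℕ) ≤ c e.1 by omega) hl hl0 hd.2.2.symm
      linarith
    · have h1 := h.above (show (e.2 : ℕ) ≤ c e.1 by omega) hj hj0 hd.2.1
      have h2 := h.above (show (e.2 : ℕ) ≤ c e.1 by omega) hk hk0 hd.2.2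
      linarith

/-- The polygon bounded by the three chains is star-shaped. -/
lemma exists_above_all (h : IsDoubleCircle s c V) :
    (⋂ e ∈ (Finset.univ : Finset (ChainIndex c)),
      {x | 0 < so s (V e.1 e.2) (V e.1 (e.2 + 1)) x}).Nonempty := by
  refine Convex.helly_theorem' (𝕜 := ℝ) (fun e _ => convex_so_pos _ _ _) fun I _ hI => ?_
  have hrank : Module.finrank ℝ Plane = 2 := finrank_euclideanSpace_fin
  rw [hrank] at hI
  obtain ⟨a, b, d, hsub⟩ : ∃ a b d : ChainIndex c, ∀ e ∈ I, e = a ∨ e = b ∨ e = d := by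
    have a0 : ChainIndex c := ⟨0, 0⟩
    interval_cases hc : I.card
    · rw [Finset.card_eq_zero] at hc
      exact ⟨a0, a0, a0, by simp [hc]⟩
    · obtain ⟨a, rfl⟩ := Finset.card_eq_one.1 hc
      exact ⟨a, a, a, by simp⟩
    · obtain ⟨a, b, -, rfl⟩ := Finset.card_eq_two.1 hc
      exact ⟨a, b, b, by simp⟩
    · obtain ⟨a, b, d, -, -, -, rfl⟩ := Finset.card_eq_three.1 hc
      exact ⟨a, b, d, by simp⟩
  obtain ⟨x, hx⟩ := h.exists_above_three a b d
  exact ⟨x, Set.mem_iInter₂.2 fun e he => hx e (hsub e he)⟩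

/-- Extending a chord by one edge adds a positive area and subtracts that of a triangle of negative
orientation, so positivity passes from edges to chords. -/
lemma so_chord_pos (h : IsDoubleCircle s c V) {x : Plane}
    (hx : ∀ i, ∀ j ≤ c i, 0 < so s (V i j) (V i (j + 1)) x) {i : Fin 3} {j k : ℕ} (hjk : j < k)
    (hk : k ≤ c i + 1) : 0 < so s (V i j) (V i k) x := by
  induction k, hjk using Nat.le_induction with
  | base => exact hx i j (by omega)
  | succ k hjk ih =>
    have h1 := ih (by omega)
    have h2 := hx i k (by omega)
    have h3 := h.bend i j k (k + 1) hjk (Nat.lt_succ_self _) hk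
    have hsum := so_sum s (V i j) (V i k) (V i (k + 1)) x
    have e := so_swap_left s (V i j) (V i (k + 1)) x
    linarith

/-- A generalized double circle is a fan around some point in general position to it. -/
lemma exists_isFan (h : IsDoubleCircle s c V) :
    ∃ x, IsFan s c x V ∧ GeneralPosition (chainPoints c V ∪ {x}) ∧
      x ∈ convexHull ℝ (chainPoints c V) := by
  obtain ⟨x, hx, hgen⟩ := exists_mem_open_so_ne_zero (finite_chainPoints c V)
    (isOpen_biInter_finset fun e _ => isOpen_Ioi.preimage (continuous_so s (V e.1 e.2) _))
    h.exists_above_all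
  have hx' : ∀ i, ∀ j ≤ c i, 0 < so s (V i j) (V i (j + 1)) x := fun i j hj =>
    Set.mem_iInter₂.1 hx ⟨i, ⟨j, by omega⟩⟩ (Finset.mem_univ _)
  have hc : ∀ i, 0 < so s (V i 0) (V (i + 1) 0) x := fun i => by
    rw [← h.glue]; exact h.so_chord_pos hx' (Nat.succ_pos _) le_rfl
  refine ⟨x, ⟨h.glue, fun i j k h1 h2 => ?_, IsFrame.corner_of_pos hc,
    fun i i' j hj hne => h.frame.corner i ⟨i', j, hj, rfl⟩ hne⟩, h.gp.union_singleton hgen,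
    h.frame.mem_convexHull hc⟩
  rw [so_rot]; exact h.so_chord_pos hx' h1 h2

lemma isMountain (h : IsDoubleCircle s c V) {i : Fin 3} {j k : ℕ} (hk : k ≤ c i + 1) :
    IsMountain s (V i) j k := fun l h1 h2 => by
  rw [so_swap]; linarith [h.bend i j l k h1 h2 hk]

end IsDoubleCircle

lemma IsGeneralizedDoubleCircle.exists_isDoubleCircle {c : Fin 3 → ℕ} (hc : ∀ i, 0 < c i)
    {P : Set Plane} (hP : IsGeneralizedDoubleCircle c P) :
    ∃ s V, P = chainPoints c V ∧ hull P = Set.range (fun i => V i 0) ∧ IsDoubleCircle s c V := by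
  obtain ⟨hgp, V, hglue, rfl, hcard, hhull, -, hpoly, hun⟩ := hP
  change GeneralPosition (chainPoints c V) at hgp
  change (chainPoints c V).encard = _ at hcard
  change hull (chainPoints c V) = _ at hhull
  change ∀ i, ∀ j ≤ c i, IsUnavoidableEdge (chainPoints c V) _ _ at hun
  have hinj : Function.Injective fun a : ChainIndex c => V a.1 a.2 := by
    rw [← Set.injOn_univ]
    refine Set.finite_univ.injOn_of_encard_image_eq ?_
    rw [Set.image_univ, show Set.range (fun a : ChainIndex c => V a.1 a.2) = chainPoints c V from ?_,
      hcard]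
    · rw [Set.encard_univ, ENat.card_eq_coe_fintype_card, Fintype.card_sigma]
      simp only [Fintype.card_fin, Finset.sum_add_distrib, Finset.sum_const, Finset.card_univ,
        smul_eq_mul, mul_one]
      rw [add_comm]
    · ext p
      constructor
      · rintro ⟨⟨i, j⟩, rfl⟩; exact ⟨i, j, by omega, rfl⟩
      · rintro ⟨i, j, hj, rfl⟩; exact ⟨⟨i, ⟨j, by omega⟩⟩, rfl⟩
  have hinj' : ∀ {i i' : Fin 3} {j j' : ℕ}, j ≤ c i → j' ≤ c i' → V i j = V i' j' →
      i = i' ∧ j = j' := by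
    intro i i' j j' hj hj' e
    have := @hinj ⟨i, ⟨j, by omega⟩⟩ ⟨i', ⟨j', by omega⟩⟩ e
    simp only [Sigma.mk.injEq] at this
    obtain ⟨rfl, h2⟩ := this
    exact ⟨rfl, by simpa using h2⟩
  obtain ⟨s, hs⟩ := exists_isFrame (finite_chainPoints c V) hgp (C := fun i => V i 0)
    (fun i j e => (hinj' (Nat.zero_le _) (Nat.zero_le _) e).1) hhull
  refine ⟨s, V, rfl, hhull, hgp, hs, hc, hglue, hinj, fun i j k l h1 h2 h3 => ?_, hun⟩
  -- The chain is on the inner side of its hull edge, which decides between the two orientations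
  -- allowed for the convex polygon.
  have hbase : 0 < so s (V i 0) (V i (c i + 1)) (V i 1) := by
    rw [hglue]
    refine hs.pos i _ ⟨i, 1, hc i, rfl⟩ (fun e => ?_) fun e => ?_
    · exact absurd (hinj' (hc i) (Nat.zero_le _) e).2 one_ne_zero
    · exact absurd (hinj' (hc i) (Nat.zero_le _) e).2 one_ne_zero
  rw [so_swap] at hbase
  rcases hs.sign with rfl | rfl <;> rcases hpoly i with hp | hp
  · have := hp 0 1 (c i + 1) Nat.one_pos (by have := hc i; omega) le_rfl
    simp only [so] at *; linarith
  · have := hp j k l h1 h2 h3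
    simp only [so] at *; linarith
  · have := hp j k l h1 h2 h3
    simp only [so] at *; linarith
  · have := hp 0 1 (c i + 1) Nat.one_pos (by have := hc i; omega) le_rfl
    simp only [so] at *; linarith

/-! ### Optimal assignments and potentials -/

/-- Difference constraints are solvable when every cycle has positive weight. With the first
potential set to 0, Fourier–Motzkin elimination of `x` gives the bounds on `y`. -/
lemma exists_three_potentials {d : Fin 3 → Fin 3 → ℝ} (h2 : ∀ i j, i ≠ j → 0 < d i j + d j i)
    (h3 : 0 < d 0 1 + d 1 2 + d 2 0) (h3' : 0 < d 0 2 + d 2 1 + d 1 0) :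
    ∃ u : Fin 3 → ℝ, ∀ i j, i ≠ j → u j - u i < d i j := by
  have a01 := h2 0 1 (by decide)
  have a02 := h2 0 2 (by decide)
  have a12 := h2 1 2 (by decide)
  obtain ⟨y, hy1, hy2⟩ := exists_between
    (show max (-d 2 0) (-d 1 0 - d 2 1) < min (d 0 2) (d 0 1 + d 1 2) by
      rw [max_lt_iff, lt_min_iff, lt_min_iff]
      exact ⟨⟨by linarith, by linarith⟩, by linarith, by linarith⟩)
  rw [max_lt_iff] at hy1
  rw [lt_min_iff] at hy2
  obtain ⟨x, hx1, hx2⟩ := exists_between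
    (show max (-d 1 0) (y - d 1 2) < min (d 0 1) (y + d 2 1) by
      rw [max_lt_iff, lt_min_iff, lt_min_iff]
      exact ⟨⟨by linarith, by linarith⟩, by linarith, by linarith⟩)
  rw [max_lt_iff] at hx1
  rw [lt_min_iff] at hx2
  refine ⟨![0, x, y], fun i j hij => ?_⟩
  fin_cases i <;> fin_cases j <;> first
    | exact absurd rfl hij
    | (simp only [Fin.zero_eta, Fin.mk_one, Fin.reduceFinMk, Fin.isValue, Matrix.cons_val]
       linarith)

section Assignment

variable {N : Type*} {c : Fin 3 → ℕ} {L : Fin 3 → N → ℝ}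

/-- The cost of an assignment of the elements of `N` to three classes of prescribed sizes. -/
def assignmentCost (L : Fin 3 → N → ℝ) (e : (Σ i : Fin 3, Fin (c i)) ≃ N) : ℝ :=
  ∑ a, L a.1 (e a)

lemma cost_exchange_two {e : (Σ i : Fin 3, Fin (c i)) ≃ N}
    (he : ∀ e' : (Σ i : Fin 3, Fin (c i)) ≃ N, assignmentCost L e ≤ assignmentCost L e')
    {a b : Σ i : Fin 3, Fin (c i)}
    (hab : a ≠ b) : L a.1 (e a) + L b.1 (e b) ≤ L a.1 (e b) + L b.1 (e a) := by
  have h := sub_nonneg.2 (he ((Equiv.swap a b).trans e))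
  rw [assignmentCost, assignmentCost, ← Finset.sum_sub_distrib,
    Fintype.sum_eq_add a b hab fun x hx => by
      simp [Equiv.swap_apply_of_ne_of_ne hx.1 hx.2]] at h
  simp only [Equiv.trans_apply, Equiv.swap_apply_left, Equiv.swap_apply_right] at h
  linarith

lemma cost_exchange_three {e : (Σ i : Fin 3, Fin (c i)) ≃ N}
    (he : ∀ e' : (Σ i : Fin 3, Fin (c i)) ≃ N, assignmentCost L e ≤ assignmentCost L e')
    {a b d : Σ i : Fin 3, Fin (c i)}
    (hab : a ≠ b) (had : a ≠ d) (hbd : b ≠ d) :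
    L a.1 (e a) + L b.1 (e b) + L d.1 (e d) ≤ L a.1 (e b) + L b.1 (e d) + L d.1 (e a) := by
  have h := sub_nonneg.2 (he (((Equiv.swap b d).trans (Equiv.swap a b)).trans e))
  rw [assignmentCost, assignmentCost, ← Finset.sum_sub_distrib,
    ← Finset.sum_subset (Finset.subset_univ {a, b, d}) fun x _ hx => by
      simp only [Finset.mem_insert, Finset.mem_singleton, not_or] at hx
      simp [Equiv.swap_apply_of_ne_of_ne hx.1 hx.2.1, Equiv.swap_apply_of_ne_of_ne hx.2.1 hx.2.2],
    Finset.sum_insert (by simp [hab, had]), Finset.sum_pair hbd] at h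
  simp only [Equiv.trans_apply, Equiv.swap_apply_left, Equiv.swap_apply_right,
    Equiv.swap_apply_of_ne_of_ne hab had, Equiv.swap_apply_of_ne_of_ne had.symm hbd.symm] at h
  linarith

/-- Duality for a minimal assignment. The weight from class `i` to class `j` is the least cost of
moving an element that way, attained at `κ i j`; exchanges along cycles cannot gain, and `h2`, `h3`
exclude ties. -/
lemma exists_assignment_potentials (hc : ∀ i, 0 < c i) (e₀ : (Σ i : Fin 3, Fin (c i)) ≃ N)
    (h2 : ∀ i j p q, i ≠ j → p ≠ q → L i p + L j q ≠ L j p + L i q)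
    (h3 : ∀ p q r, p ≠ q → p ≠ r → q ≠ r → L 0 p + L 1 q + L 2 r ≠ L 1 p + L 2 q + L 0 r) :
    ∃ (e : (Σ i : Fin 3, Fin (c i)) ≃ N) (u : Fin 3 → ℝ), ∀ i j, i ≠ j → ∀ k : Fin (c i),
      L i (e ⟨i, k⟩) + u j < L j (e ⟨i, k⟩) + u i := by
  have : Finite N := Finite.of_equiv _ e₀
  have : Finite ((Σ i : Fin 3, Fin (c i)) ≃ N) :=
    Finite.of_injective (fun e => (e : _ → N)) DFunLike.coe_injective
  have : Nonempty ((Σ i : Fin 3, Fin (c i)) ≃ N) := ⟨e₀⟩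
  obtain ⟨e, he⟩ := Finite.exists_min (assignmentCost (c := c) L)
  have hmin : ∀ i j : Fin 3, ∃ k : Fin (c i), ∀ k' : Fin (c i),
      L j (e ⟨i, k⟩) - L i (e ⟨i, k⟩) ≤ L j (e ⟨i, k'⟩) - L i (e ⟨i, k'⟩) := fun i j => by
    have : Nonempty (Fin (c i)) := ⟨⟨0, hc i⟩⟩
    exact Finite.exists_min fun k : Fin (c i) => L j (e ⟨i, k⟩) - L i (e ⟨i, k⟩)
  choose κ hκ using hmin
  have hne : ∀ {i j : Fin 3} (k : Fin (c i)) (l : Fin (c j)), i ≠ j →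
      (⟨i, k⟩ : Σ i : Fin 3, Fin (c i)) ≠ ⟨j, l⟩ := fun k l hij h => hij (by injection h)
  have hpot : ∃ u : Fin 3 → ℝ, ∀ i j, i ≠ j →
      u j - u i < L j (e ⟨i, κ i j⟩) - L i (e ⟨i, κ i j⟩) := by
    refine exists_three_potentials
      (d := fun i j => L j (e ⟨i, κ i j⟩) - L i (e ⟨i, κ i j⟩)) ?_ ?_ ?_
    · intro i j hij
      have h1 := cost_exchange_two he (hne (κ i j) (κ j i) hij)
      have h4 := h2 i j _ _ hij (e.injective.ne (hne (κ i j) (κ j i) hij))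
      have := lt_of_le_of_ne h1 (by rwa [add_comm (L i _) (L j (e ⟨i, _⟩))])
      dsimp only at this
      linarith
    · have n1 := hne (κ 0 1) (κ 1 2) (by decide)
      have n2 := hne (κ 0 1) (κ 2 0) (by decide)
      have n3 := hne (κ 1 2) (κ 2 0) (by decide)
      have h1 := cost_exchange_three he n2 n1 n3.symm
      have h4 := h3 _ _ _ (e.injective.ne n1) (e.injective.ne n2) (e.injective.ne n3)
      dsimp only at h1
      have := lt_of_le_of_ne (by linarith) h4
      linarith
    · have n1 := hne (κ 0 2) (κ 1 0) (by decide)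
      have n2 := hne (κ 0 2) (κ 2 1) (by decide)
      have n3 := hne (κ 1 0) (κ 2 1) (by decide)
      have h1 := cost_exchange_three he n1 n2 n3
      have h4 := h3 _ _ _ (e.injective.ne n3) (e.injective.ne n1.symm) (e.injective.ne n2.symm)
      dsimp only at h1
      have := lt_of_le_of_ne (show L 1 (e ⟨1, κ 1 0⟩) + L 2 (e ⟨2, κ 2 1⟩) + L 0 (e ⟨0, κ 0 2⟩) ≤
        L 0 (e ⟨1, κ 1 0⟩) + L 1 (e ⟨2, κ 2 1⟩) + L 2 (e ⟨0, κ 0 2⟩) by linarith) h4.symm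
      linarith
  obtain ⟨u, hu⟩ := hpot
  refine ⟨e, u, fun i j hij k => ?_⟩
  have h1 := hu i j hij
  have h4 := hκ i j k
  linarith

end Assignment

/-! ### Partitioning a triangle around a point -/

namespace IsFrame

variable {s : ℝ} {C : Fin 3 → Plane} {Q : Set Plane}

/-- The side of the line through `C (i + 1)` and `p` on which `x` lies is decided by comparing
ratios of two barycentric coordinates. -/
lemma area_mul_so (s : ℝ) (C : Fin 3 → Plane) (i : Fin 3) (p x : Plane) :
    so s (C i) (C (i + 1)) (C (i + 2)) * so s (C (i + 1)) p x =
      so s (C i) (C (i + 1)) p * so s (C (i + 1)) (C (i + 2)) x -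
        so s (C i) (C (i + 1)) x * so s (C (i + 1)) (C (i + 2)) p := by
  simp only [so, orient]; ring

lemma so_eq_zero_of_proportional (h : IsFrame s C Q) {i : Fin 3} {p x : Plane}
    (e : so s (C i) (C (i + 1)) p * so s (C (i + 1)) (C (i + 2)) x =
        so s (C i) (C (i + 1)) x * so s (C (i + 1)) (C (i + 2)) p) : so s (C (i + 1)) p x = 0 := by
  have := area_mul_so s C i p x
  rw [e, sub_self] at this
  exact (mul_eq_zero.1 this).resolve_left (h.area i).ne'

lemma pos_of_inner (h : IsFrame s C Q) {p : Plane} (hp : p ∈ Q \ Set.range C) (i : Fin 3) :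
    0 < so s (C i) (C (i + 1)) p :=
  h.pos i p hp.1 (fun e => hp.2 ⟨_, e.symm⟩) fun e => hp.2 ⟨_, e.symm⟩

lemma mem_line_of_so_eq_zero (h : IsFrame s C Q) {i : Fin 3} {p x : Plane}
    (hp : p ∈ Q \ Set.range C) (e : so s (C i) p x = 0) : x ∈ line[ℝ, C i, p] :=
  mem_line_of_orient_eq_zero (fun e => hp.2 ⟨_, e⟩)
    ((mul_eq_zero.1 e).resolve_left h.sign_ne_zero)

lemma mul_ne_mul_next (h : IsFrame s C Q) (hQ : GeneralPosition Q) (i : Fin 3) {p q : Plane}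
    (hp : p ∈ Q \ Set.range C) (hq : q ∈ Q \ Set.range C) (hpq : p ≠ q) :
    so s (C i) (C (i + 1)) p * so s (C (i + 1)) (C (i + 2)) q ≠
      so s (C (i + 1)) (C (i + 2)) p * so s (C i) (C (i + 1)) q := fun e =>
  hQ.so_ne_zero h.sign_ne_zero (h.mem (i + 1)) hp.1 hq.1 (fun e => hp.2 ⟨_, e⟩)
    (fun e => hq.2 ⟨_, e⟩) hpq (h.so_eq_zero_of_proportional (by rw [e, mul_comm]))

lemma mul_ne_mul (h : IsFrame s C Q) (hQ : GeneralPosition Q) {i j : Fin 3} (hij : i ≠ j)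
    {p q : Plane} (hp : p ∈ Q \ Set.range C) (hq : q ∈ Q \ Set.range C) (hpq : p ≠ q) :
    so s (C i) (C (i + 1)) p * so s (C j) (C (j + 1)) q ≠
      so s (C j) (C (j + 1)) p * so s (C i) (C (i + 1)) q := by
  rcases fin3_cases i j with rfl | rfl | rfl
  · exact absurd rfl hij
  · have := h.mul_ne_mul_next hQ i hp hq hpq
    rwa [fin3_add_two] at this
  · have := h.mul_ne_mul_next hQ j hp hq hpq
    rw [fin3_add_two] at this
    exact this.symm

/-- A form of Ceva's theorem. -/
lemma mul_mul_ne_mul_mul (h : IsFrame s C Q) (hC : Function.Injective C)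
    (hQ : GeneralPlusPosition Q) {p q r : Plane}
    (hp : p ∈ Q \ Set.range C) (hq : q ∈ Q \ Set.range C) (hr : r ∈ Q \ Set.range C)
    (hpq : p ≠ q) (hpr : p ≠ r) (hqr : q ≠ r) :
    so s (C 0) (C 1) p * so s (C 1) (C 2) q * so s (C 2) (C 0) r ≠
      so s (C 1) (C 2) p * so s (C 2) (C 0) q * so s (C 0) (C 1) r := by
  intro e
  have p0 : 0 < so s (C 0) (C 1) p := h.pos_of_inner hp 0
  have p1 : 0 < so s (C 1) (C 2) p := h.pos_of_inner hp 1
  have q1 : 0 < so s (C 1) (C 2) q := h.pos_of_inner hq 1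
  have q2 : 0 < so s (C 2) (C 0) q := h.pos_of_inner hq 2
  -- The coordinates are those of the intersection of the lines `C 1 p` and `C 2 q`; the assumed
  -- equality puts this point on `C 0 r` as well.
  obtain ⟨x, κ, hκ, hx⟩ := h.exists_point
    ![so s (C 0) (C 1) p * so s (C 1) (C 2) q, so s (C 1) (C 2) p * so s (C 1) (C 2) q,
      so s (C 1) (C 2) p * so s (C 2) (C 0) q] (by
        intro i; fin_cases i <;> simp <;> positivity)
  have x0 := hx 0
  have x1 := hx 1
  have x2 := hx 2
  simp only [Fin.isValue, zero_add, Fin.reduceAdd, Matrix.cons_val] at x0 x1 x2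
  have e1 : so s (C 1) p x = 0 := h.so_eq_zero_of_proportional (i := 0) (by
    simp only [Fin.isValue, zero_add, x0, x1]; ring)
  have e2 : so s (C 2) q x = 0 := h.so_eq_zero_of_proportional (i := 1) (by
    simp only [Fin.isValue, Fin.reduceAdd, x1, x2]; ring)
  have e0 : so s (C 0) r x = 0 := h.so_eq_zero_of_proportional (i := 2) (by
    simp only [Fin.isValue, Fin.reduceAdd, x2, x0]; linear_combination κ * e)
  refine hQ.2 ![C 1, p, C 2, q, C 0, r] ?_ ?_ ⟨x, h.mem_line_of_so_eq_zero hp e1,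
    h.mem_line_of_so_eq_zero hq e2, h.mem_line_of_so_eq_zero hr e0⟩
  · have n1 : ∀ i, C i ≠ p := fun i e => hp.2 ⟨i, e⟩
    have n2 : ∀ i, C i ≠ q := fun i e => hq.2 ⟨i, e⟩
    have n3 : ∀ i, C i ≠ r := fun i e => hr.2 ⟨i, e⟩
    intro i j
    fin_cases i <;> fin_cases j <;>
      simp [n1, n2, n3, (n1 _).symm, (n2 _).symm, (n3 _).symm, hpq, hpr, hqr, hpq.symm, hpr.symm,
        hqr.symm, hC.eq_iff]
  · intro i
    fin_cases i
    · exact h.mem 1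
    · exact hp.1
    · exact h.mem 2
    · exact hq.1
    · exact h.mem 0
    · exact hr.1

/-- The points inside a triangle can be distributed to the three triangles spanned by its sides and
some further point in any given proportion. -/
lemma exists_partition (h : IsFrame s C Q) (hC : Function.Injective C)
    (hQ : GeneralPlusPosition Q) {c : Fin 3 → ℕ} (hc : ∀ i, 0 < c i)
    (e₀ : (Σ i : Fin 3, Fin (c i)) ≃ ↥(Q \ Set.range C)) :
    ∃ (e : (Σ i : Fin 3, Fin (c i)) ≃ ↥(Q \ Set.range C)) (x : Plane),
      (∀ i, 0 < so s (C i) (C (i + 1)) x) ∧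
      (∀ a, 0 < so s (C a.1) (e a) x) ∧ ∀ a, 0 < so s (e a) (C (a.1 + 1)) x := by
  have hlog : ∀ i (p : ↥(Q \ Set.range C)), Real.exp (Real.log (so s (C i) (C (i + 1)) p)) =
      so s (C i) (C (i + 1)) p := fun i p => Real.exp_log (h.pos_of_inner p.2 i)
  have hpot : ∃ (e : (Σ i : Fin 3, Fin (c i)) ≃ ↥(Q \ Set.range C)) (u : Fin 3 → ℝ),
      ∀ i j, i ≠ j → ∀ k : Fin (c i), Real.log (so s (C i) (C (i + 1)) (e ⟨i, k⟩)) + u j <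
        Real.log (so s (C j) (C (j + 1)) (e ⟨i, k⟩)) + u i := by
    refine exists_assignment_potentials
      (L := fun i (p : ↥(Q \ Set.range C)) => Real.log (so s (C i) (C (i + 1)) p)) hc e₀ ?_ ?_
    · intro i j p q hij hpq he
      have := congrArg Real.exp he
      rw [Real.exp_add, Real.exp_add, hlog, hlog, hlog, hlog] at this
      exact h.mul_ne_mul hQ.1 hij p.2 q.2 (Subtype.coe_injective.ne hpq) this
    · intro p q r hpq hpr hqr he
      have := congrArg Real.exp he
      simp only [Real.exp_add, hlog] at this
      exact h.mul_mul_ne_mul_mul hC hQ p.2 q.2 r.2 (Subtype.coe_injective.ne hpq)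
        (Subtype.coe_injective.ne hpr) (Subtype.coe_injective.ne hqr) this
  obtain ⟨e, u, hu⟩ := hpot
  -- With these coordinates, the ratio of the area of `p` over a side to that of `x` is smallest at
  -- the side of its own class, so `p` lies in the triangle of `x` and that side.
  obtain ⟨x, κ, hκ, hx⟩ := h.exists_point (fun i => Real.exp (u i)) fun i => Real.exp_pos _
  have key : ∀ a : Σ i : Fin 3, Fin (c i), ∀ j, a.1 ≠ j →
      so s (C a.1) (C (a.1 + 1)) (e a) * so s (C j) (C (j + 1)) x <
        so s (C j) (C (j + 1)) (e a) * so s (C a.1) (C (a.1 + 1)) x := by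
    intro a j hj
    have h1 := Real.exp_lt_exp.2 (hu a.1 j hj a.2)
    rw [Real.exp_add, Real.exp_add, hlog, hlog] at h1
    rw [hx, hx]
    have := mul_lt_mul_of_pos_left h1 hκ
    linarith
  refine ⟨e, x, fun i => by rw [hx]; exact mul_pos hκ (Real.exp_pos _), fun a => ?_, fun a => ?_⟩
  · have h1 := key a (a.1 + 2) (fin3_ne_add_two _)
    have h4 := area_mul_so s C (a.1 + 2) (e a) x
    simp only [fin3_two_add_one, fin3_add_two_add_two] at h1 h4
    have h5 := h.area (a.1 + 2)
    simp only [fin3_two_add_one, fin3_add_two_add_two] at h5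
    exact pos_of_mul_pos_right (by rw [h4]; linarith) h5.le
  · have h1 := key a (a.1 + 1) (fin3_ne_succ _)
    have h4 := area_mul_so s C a.1 (e a) x
    rw [← fin3_add_two] at h1
    rw [so_swap_left]
    refine pos_of_mul_pos_right ?_ (h.area a.1).le
    rw [mul_neg, h4]; linarith

end IsFrame

/-- The chain from `a` to `b` through the points `q 0, …, q (n - 1)`. -/
def chainOf {n : ℕ} (a : Plane) (q : Fin n → Plane) (b : Plane) : ℕ → Plane
  | 0 => a
  | j + 1 => if h : j < n then q ⟨j, h⟩ else b

/-- Points in an angle with apex `x` can be sorted by their direction from `x`. -/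
lemma exists_sorted_chain {s : ℝ} {x a b : Plane} {n : ℕ} {q : Fin n → Plane}
    (hab : 0 < so s x a b) (ha : ∀ k, 0 < so s x a (q k)) (hb : ∀ k, 0 < so s x (q k) b)
    (hne : ∀ k l, k ≠ l → so s x (q k) (q l) ≠ 0) :
    ∃ σ : Equiv.Perm (Fin n), ∀ j k, j < k → k ≤ n + 1 →
      0 < so s x (chainOf a (q ∘ σ) b j) (chainOf a (q ∘ σ) b k) := by
  -- This ratio increases with the angle at `x` from `a` towards `b`, by the Plücker relation.
  refine ⟨Tuple.sort fun k => so s x a (q k) / so s x (q k) b, fun j k hjk hk => ?_⟩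
  have hmono := Tuple.monotone_sort fun k => so s x a (q k) / so s x (q k) b
  obtain ⟨k, rfl⟩ : ∃ l, k = l + 1 := ⟨k - 1, by omega⟩
  rcases j with _ | j
  · by_cases h : k < n
    · simpa [chainOf, h] using ha _
    · simpa [chainOf, h] using hab
  have hj : j < n := by omega
  by_cases h : k < n
  · simp only [chainOf, hj, h, dif_pos, Function.comp_apply]
    have h1 := hmono (show (⟨j, hj⟩ : Fin n) ≤ ⟨k, h⟩ from Fin.mk_le_mk.2 (by omega))
    simp only [Function.comp_apply] at h1
    rw [div_le_div_iff₀ (hb _) (hb _)] at h1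
    have hn := hne _ _ ((Tuple.sort fun k => so s x a (q k) / so s x (q k) b).injective.ne
      (show (⟨j, hj⟩ : Fin n) ≠ ⟨k, h⟩ from fun e => by
        have := Fin.mk.inj e; omega))
    refine lt_of_le_of_ne ?_ hn.symm
    have hp := so_plucker s x a (q (Tuple.sort (fun k => so s x a (q k) / so s x (q k) b) ⟨j, hj⟩))
      (q (Tuple.sort (fun k => so s x a (q k) / so s x (q k) b) ⟨k, h⟩)) b
    exact nonneg_of_mul_nonneg_right (by linarith) hab
  · simpa [chainOf, hj, h] using hb _

/-- Every set in general⁺ position with a triangular hull is a fan with chains of any given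
positive lengths, up to the addition of the center. -/
lemma IsFrame.exists_isFan {s : ℝ} {C : Fin 3 → Plane} {Q : Set Plane} (h : IsFrame s C Q)
    (hfin : Q.Finite) (hC : Function.Injective C) (hQ : GeneralPlusPosition Q) {c : Fin 3 → ℕ}
    (hc : ∀ i, 0 < c i) (hcard : Q.encard = ((3 + ∑ i, c i : ℕ) : ℕ∞)) :
    ∃ (x : Plane) (w : Fin 3 → ℕ → Plane), Q = chainPoints c w ∧ (∀ i, w i 0 = C i) ∧
      IsFan s c x w ∧ (∀ i, IsMountain s (w i) 0 (c i + 1)) ∧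
      GeneralPosition (Q ∪ {x}) ∧ x ∈ convexHull ℝ Q := by
  have hsub : Set.range C ⊆ Q := by rintro _ ⟨i, rfl⟩; exact h.mem i
  have : Finite ↥(Q \ Set.range C) := hfin.subset Set.sdiff_subset
  have e₀ : Nonempty ((Σ i : Fin 3, Fin (c i)) ≃ ↥(Q \ Set.range C)) := by
    refine Finite.card_eq.1 ?_
    have h1 : Q.ncard = 3 + ∑ i, c i := by rw [Set.ncard, hcard]; rfl
    have h2 : (Set.range C).ncard = 3 := by
      rw [← Set.image_univ, Set.ncard_image_of_injective _ hC, Set.ncard_univ,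
        Nat.card_eq_fintype_card, Fintype.card_fin]
    rw [Nat.card_coe_set_eq, Set.ncard_sdiff hsub, h1, h2, Nat.card_eq_fintype_card,
      Fintype.card_sigma]
    simp
  obtain ⟨e, x₀, h1, h2, h3⟩ := h.exists_partition hC hQ hc e₀.some
  -- The partition only requires strict inequalities on the center, so it survives a perturbation
  -- into general position.
  obtain ⟨x, ⟨⟨hx1, hx2⟩, hx3⟩, hgen⟩ := exists_mem_open_so_ne_zero hfin
    (U := ((⋂ i, {x | 0 < so s (C i) (C (i + 1)) x}) ∩ ⋂ a, {x | 0 < so s (C a.1) (e a) x}) ∩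
      ⋂ a, {x | 0 < so s (e a) (C (a.1 + 1)) x})
    (((isOpen_iInter_of_finite fun i => isOpen_Ioi.preimage (continuous_so _ _ _)).inter
      (isOpen_iInter_of_finite fun a => isOpen_Ioi.preimage (continuous_so _ _ _))).inter
      (isOpen_iInter_of_finite fun a => isOpen_Ioi.preimage (continuous_so _ _ _)))
    ⟨x₀, ⟨Set.mem_iInter.2 h1, Set.mem_iInter.2 h2⟩, Set.mem_iInter.2 h3⟩
  replace hx1 := Set.mem_iInter.1 hx1
  replace hx2 := Set.mem_iInter.1 hx2
  replace hx3 := Set.mem_iInter.1 hx3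
  choose σ hσ using fun i => exists_sorted_chain (s := s) (x := x) (a := C i) (b := C (i + 1))
    (q := fun k : Fin (c i) => (e ⟨i, k⟩ : Plane)) (by rw [so_rot]; exact hx1 i)
    (fun k => by rw [so_rot]; exact hx2 ⟨i, k⟩) (fun k => by rw [so_rot]; exact hx3 ⟨i, k⟩)
    (fun k l hkl => by
      have hne : (e ⟨i, k⟩ : Plane) ≠ e ⟨i, l⟩ := Subtype.coe_injective.ne (e.injective.ne
        fun he => hkl (by simpa using he))
      have := hgen _ (e ⟨i, k⟩).2.1 _ (e ⟨i, l⟩).2.1 hne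
      rw [so, one_mul] at this
      rw [so_rot]
      exact mul_ne_zero h.sign_ne_zero this)
  set w : Fin 3 → ℕ → Plane := fun i =>
    chainOf (C i) ((fun k : Fin (c i) => (e ⟨i, k⟩ : Plane)) ∘ σ i) (C (i + 1)) with hw
  have hw1 : ∀ i j (hj : j < c i), w i (j + 1) = e ⟨i, σ i ⟨j, hj⟩⟩ := fun i j hj => by
    simp [hw, chainOf, hj]
  have hmem : ∀ i j, j ≤ c i → w i j ∈ Q := by
    intro i j hj
    rcases j with _ | j
    · exact h.mem i
    · rw [hw1 i j hj]; exact (e _).2.1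
  have hglue : ∀ i, w i (c i + 1) = C (i + 1) := fun i => by simp [hw, chainOf]
  refine ⟨x, w, ?_, fun i => rfl, ⟨hglue, hσ, IsFrame.corner_of_pos hx1, fun i i' j hj hne =>
    h.corner i (hmem i' j hj) hne⟩, fun i l hl0 hl => ?_, hQ.1.union_singleton hgen,
    h.mem_convexHull hx1⟩
  · ext p
    constructor
    · intro hp
      by_cases hpC : p ∈ Set.range C
      · obtain ⟨i, rfl⟩ := hpC
        exact ⟨i, 0, Nat.zero_le _, rfl⟩
      · obtain ⟨⟨i, k⟩, hk⟩ := e.surjective ⟨p, hp, hpC⟩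
        refine ⟨i, ((σ i).symm k : ℕ) + 1, ((σ i).symm k).2, ?_⟩
        rw [hw1 i _ ((σ i).symm k).2]
        simp [hk]
    · rintro ⟨i, j, hj, rfl⟩
      exact hmem i j hj
  · rw [hglue]
    obtain ⟨l, rfl⟩ : ∃ l', l = l' + 1 := ⟨l - 1, by omega⟩
    rw [hw1 i l (by omega)]
    exact h.pos_of_inner (e _).2 i

/-- A generalized double circle and a set in general⁺ position with equally many points and a
triangular hull have a compatible triangulation with one Steiner point per set. -/
theorem IsGeneralizedDoubleCircle.hasCompatibleTriangulationWithSteiner_one {c : Fin 3 → ℕ}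
    (hc : ∀ i, 0 < c i) {P Q : Set Plane} (hP : IsGeneralizedDoubleCircle c P)
    (hQ : GeneralPlusPosition Q) (hcard : P.encard = Q.encard) (f₀ : hull P ≃ hull Q) :
    HasCompatibleTriangulationWithSteiner P Q f₀ 1 := by
  have hPcard : P.encard = ((3 + ∑ i, c i : ℕ) : ℕ∞) := by
    obtain ⟨-, V, -, -, h, -⟩ := hP
    exact h
  obtain ⟨s, V, rfl, hhull, hV⟩ := hP.exists_isDoubleCircle hc
  have hmem : ∀ i, V i 0 ∈ hull (chainPoints c V) := fun i => hhull ▸ ⟨i, rfl⟩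
  have hfin : Q.Finite := by
    rw [← Set.encard_lt_top_iff, ← hcard, hPcard]
    exact ENat.natCast_lt_top _
  have hC : Function.Injective fun i => (f₀ ⟨V i 0, hmem i⟩ : Plane) := by
    intro i j e
    have := f₀.injective (Subtype.coe_injective e)
    exact (hV.eq_of_eq (Nat.zero_le _) (Nat.zero_le _) (Subtype.ext_iff.1 this)).1
  have hrange : hull Q = Set.range fun i => (f₀ ⟨V i 0, hmem i⟩ : Plane) := by
    ext q
    constructor
    · intro hq
      obtain ⟨⟨p, hp⟩, hpq⟩ := f₀.surjective ⟨q, hq⟩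
      obtain ⟨i, rfl⟩ := hhull ▸ hp
      exact ⟨i, by simp [hpq]⟩
    · rintro ⟨i, rfl⟩
      exact (f₀ _).2
  -- The corners of `Q` are labelled through `f₀`, and `t` is independent of `s`; an
  -- orientation-reversing `f₀` thus needs no separate treatment.
  obtain ⟨t, ht⟩ := exists_isFrame hfin hQ.1 hC hrange
  obtain ⟨y, w, rfl, hw0, hw, hmw, hgpw, hyw⟩ :=
    ht.exists_isFan hfin hC hQ hc (hcard.symm.trans hPcard)
  obtain ⟨x, hx, hgpx, hxV⟩ := hV.exists_isFan
  obtain ⟨f, hf, T, U, hTU⟩ := hx.exists_compatible hw hV.frame.sign_ne_zero ht.sign_ne_zero hgpx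
    hgpw (fun i j k _ hk => hV.isMountain hk) hmw
  refine ⟨{x}, {y}, by simp, by simp, ?_, ?_, hgpx, hgpw, hull_union_singleton hxV,
    hull_union_singleton hyw, f, fun p q hpq => ?_, T, U, hTU⟩
  · exact Set.disjoint_singleton_right.2 fun h => hx.ne_center' h rfl
  · exact Set.disjoint_singleton_right.2 fun h => hw.ne_center' h rfl
  · obtain ⟨q, hq⟩ := q
    obtain ⟨i, rfl⟩ := hhull ▸ hq
    rw [hf p i hpq, hw0]

end CompatTri

theorem mainTheorem9 (c₁ c₂ c₃ : ℕ) (hc₁ : 0 < c₁) (hc₂ : 0 < c₂) (hc₃ : 0 < c₃)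
    (P : Set CompatTri.Plane) (hP : CompatTri.IsGeneralizedDoubleCircle ![c₁, c₂, c₃] P)
    (Q : Set CompatTri.Plane) (hQ : CompatTri.GeneralPlusPosition Q)
    (hcard : P.encard = Q.encard)
    (hhull : (CompatTri.hull P).encard = (CompatTri.hull Q).encard)
    (f₀ : CompatTri.hull P ≃ CompatTri.hull Q) (hf₀ : CompatTri.IsCyclicMap f₀) :
    CompatTri.steinerNumber P Q f₀ ≤ 1 := by
  have hc : ∀ i, 0 < ![c₁, c₂, c₃] i := by
    intro i
    fin_cases i
    · exact hc₁
    · exact hc₂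
    · exact hc₃
  exact sInf_le ⟨1, rfl, hP.hasCompatibleTriangulationWithSteiner_one hc hQ hcard f₀⟩
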